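/- \textbf{Setting.} Let $a>0$, $\tau\ge 6$, $m\ge 10$ and $N\ge 1$ be given ($m,N$ integers), let $V_0=(-a,a)^2$, and let $S\in L^2(\mathbb R^2)$ be supported in $V_0$. Put $k_0=\frac{\pi}{30a}$ and let $k$ belong to $$\mathbb K_N=\Big\{\tfrac{\pi}{a}|\boldsymbol l| : \boldsymbol l\in\mathbb Z^2,\ 1\le|\boldsymbol l|_\infty\le N\Big\}\cup\{k_0\}.$$ Let $\Phi_k(x,y)=\frac{\mathrm i}{8k^2}\big(H_0^{(1)}(k|x-y|)-H_0^{(1)}(\mathrm ik|x-y|)\big)$ be the outgoing fundamental solution of $\Delta^2-k^4$ in $\mathbb R^2$, and let $u(x,k)=\int_{V_0}\Phi_k(x,y)S(y)\,\mathrm dy$ be the field radiated by $S$. Choose $$\lambda_1=\tfrac12,\qquad R=\tau a,\ \ \lambda_2=\tfrac12+\tfrac{\pi}{2kR}\ \text{ if } k\ne k_0,\qquad R=6a,\ \ \lambda_2=-\tfrac32\ \text{ if } k=k_0 .$$ With $\vartheta_i=i\pi/m$ put, for $j=1,\dots,m$ and $\ell=1,2$, $$\Gamma_j=\{R(\cos\vartheta,\sin\vartheta):\vartheta_{2j-2}\le\vartheta\le\vartheta_{2j}\},\qquad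 z_{j,\ell}=\lambda_\ell R(\cos\vartheta_{2j-1},\sin\vartheta_{2j-1}),$$ $\|\cdot\|_{j,\infty}=\|\cdot\|_{L^\infty(\Gamma_j)}$, $u_{j,k}=u(\cdot,k)|_{\Gamma_j}$ and $c_{j,\ell,k}=\|u_{j,k}\|_{j,\infty}/\|\Phi_k(\cdot,z_{j,\ell})\|_{j,\infty}$. For $x\in\Gamma_j$ and $r_{j,\ell}=|x-z_{j,\ell}|$ let $$A_{j,\ell,k}=\tfrac1{k^2}\big(Y_0(kr_{j,\ell})+\mathrm iH_0^{(1)}(\mathrm ikr_{j,\ell})\big),\qquad B_{j,\ell,k}=-\tfrac1{k^2}J_0(kr_{j,\ell}).$$ \textbf{Noisy data and retrieved field.} Let $\varepsilon\in(0,1)$, and let the measured moduli $p,q_1,q_2:\Gamma_j\to[0,\infty)$ satisfy $$\big\|p-|u_{j,k}|\big\|_{j,\infty}\le\varepsilon\|u_{j,k}\|_{j,\infty},\qquad \big\|q_\ell-|\hat v_{j,\ell,k}|\big\|_{j,\infty}\le\varepsilon\|\hat v_{j,\ell,k}\|_{j,\infty}\quad(\ell=1,2),$$ where $c^\varepsilon_{j,\ell,k}=\|p\|_{j,\infty}/\|\Phi_k(\cdot,z_{j,\ell})\|_{j,\infty}$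 and $\hat v_{j,\ell,k}=u_{j,k}-c^\varepsilon_{j,\ell,k}\Phi_k(\cdot,z_{j,\ell})$. The retrieved field $u^\varepsilon_{j,k}$ is the solution, at each point of $\Gamma_j$, of the linear system $$A_{j,\ell,k}\,\Re u^\varepsilon_{j,k}+B_{j,\ell,k}\,\Im u^\varepsilon_{j,k}=\frac{4}{c^\varepsilon_{j,\ell,k}}\big(q_\ell^2-p^2\big)-\frac{c^\varepsilon_{j,\ell,k}}{16}\big(A_{j,\ell,k}^2+B_{j,\ell,k}^2\big),\qquad \ell=1,2$$ (with the convention $4/0=0$, needed only if $u_{j,k}$ vanishes almost everywhere on $\Gamma_j$). \textbf{Theorem.} For each $j=1,\dots,m$ one has $\|u_{j,k}\|_{j,\infty}<\infty$, the system is uniquely solvable at every point of $\Gamma_j$, and $$\|u^\varepsilon_{j,k}-u_{j,k}\|_{j,\infty}\le C_\varepsilon\,\|u_{j,k}\|_{j,\infty},\qquad C_\varepsilon=\frac{\sqrt2\,\varepsilon\,\eta_\varepsilon}{M},$$ where $$M=\frac12\Big(1.74-\frac{3}{2\tau}\Big),\qquad \eta_\varepsilon=\frac{4(3+\varepsilon)(2+\varepsilon)^2+4(3+\varepsilon)+8}{1-\varepsilon}+4\,(c_{j,1,k}+c_{j,2,k}).$$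 -/

import Mathlib

open Real Set MeasureTheory
open scoped ENNReal

/-- The plane `ℝ²` with its Euclidean norm. -/
abbrev Plane : Type := EuclideanSpace ℝ (Fin 2)

noncomputable section

namespace PhaseRetrieval

/-! ### Bessel and Hankel functions of order zero -/

/-- Bessel function of the first kind, `J₀(z) = ∑ₙ (-1)ⁿ (z²/4)ⁿ / (n!)²`. -/
def besselJ0 (z : ℂ) : ℂ :=
  ∑' n : ℕ, (-1 : ℂ) ^ n / ((n.factorial : ℂ) ^ 2) * (z ^ 2 / 4) ^ n

/-- Bessel function of the second kind (principal branch),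
`Y₀(z) = (2/π) (log (z/2) + γ) J₀(z) - (2/π) ∑ₙ (-1)ⁿ hₙ (z²/4)ⁿ / (n!)²`,
where `γ` is Euler's constant and `hₙ = 1 + 1/2 + ⋯ + 1/n`. -/
def besselY0 (z : ℂ) : ℂ :=
  2 / (π : ℂ) * (Complex.log (z / 2) + (Real.eulerMascheroniConstant : ℂ)) * besselJ0 z
    - 2 / (π : ℂ) *
      ∑' n : ℕ, (-1 : ℂ) ^ n * ((harmonic n : ℚ) : ℂ) / ((n.factorial : ℂ) ^ 2) * (z ^ 2 / 4) ^ n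

/-- Hankel function of the first kind, `H₀⁽¹⁾ = J₀ + i Y₀`. -/
def hankelH0 (z : ℂ) : ℂ := besselJ0 z + Complex.I * besselY0 z

/-- `Φ_k(x, y) = i/(8k²) (H₀⁽¹⁾(k|x-y|) - H₀⁽¹⁾(ik|x-y|))`, the outgoing fundamental solution
of `Δ² - k⁴` in the plane. -/
def fundSol (k : ℝ) (x y : Plane) : ℂ :=
  Complex.I / (8 * (k : ℂ) ^ 2) *
    (hankelH0 ((k * dist x y : ℝ) : ℂ) - hankelH0 (Complex.I * ((k * dist x y : ℝ) : ℂ)))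

/-! ### The radiated field -/

/-- The square `V₀ = (-a, a) × (-a, a)`. -/
def square (a : ℝ) : Set Plane := {x | ∀ i, x i ∈ Ioo (-a) a}

/-- The field `u(x, k) = ∫_{V₀} Φ_k(x, y) S(y) dy` radiated by the source `S`. -/
def field (a k : ℝ) (S : Plane → ℂ) (x : Plane) : ℂ :=
  ∫ y in square a, fundSol k x y * S y

/-! ### Wave numbers, parameters and geometry -/

/-- The small wave number `k₀ = π / (30 a)`. -/
def smallWaveNumber (a : ℝ) : ℝ := π / (30 * a)

/-- The admissible wave numbers `(π/a)|l|`, `l ∈ ℤ²`, `1 ≤ |l|_∞ ≤ N`, together with `k₀`. -/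
def admissible (a : ℝ) (N : ℕ) : Set ℝ :=
  {k | ∃ l₁ l₂ : ℤ, 1 ≤ max |l₁| |l₂| ∧ max |l₁| |l₂| ≤ (N : ℤ) ∧
      k = π / a * √((l₁ : ℝ) ^ 2 + (l₂ : ℝ) ^ 2)} ∪ {smallWaveNumber a}

/-- The observation radius: `6a` if `k = k₀`, and `τa` otherwise. -/
def radius (a τ k : ℝ) : ℝ := if k = smallWaveNumber a then 6 * a else τ * a

/-- The ratios `λ_{j,ℓ}`, `ℓ = 1, 2` (indexed here by `0, 1`); they do not depend on `j`. -/
def ratio (a τ k : ℝ) : Fin 2 → ℝ :=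
  ![1 / 2, if k = smallWaveNumber a then -3 / 2 else 1 / 2 + π / (2 * k * radius a τ k)]

/-- The angles `ϑ_i = iπ/m`. -/
def gridAngle (m : ℕ) (i : ℤ) : ℝ := i * π / m

/-- The point `ρ (cos ϑ, sin ϑ)`. -/
def polar (ρ ϑ : ℝ) : Plane := !₂[ρ * Real.cos ϑ, ρ * Real.sin ϑ]

/-- The arc `Γ_j = {R (cos ϑ, sin ϑ) : ϑ_{2j-2} ≤ ϑ ≤ ϑ_{2j}}`. -/
def arc (R : ℝ) (m j : ℕ) : Set Plane :=
  polar R '' Icc (gridAngle m (2 * j - 2)) (gridAngle m (2 * j))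

/-- The auxiliary source points `z_{j,ℓ} = λ_{j,ℓ} R (cos ϑ_{2j-1}, sin ϑ_{2j-1})`. -/
def sourcePoint (a τ k : ℝ) (m j : ℕ) (l : Fin 2) : Plane :=
  polar (ratio a τ k l * radius a τ k) (gridAngle m (2 * j - 1))

/-- The norm of `L^∞(Γ)`, with respect to arc length on the curve `Γ`. -/
def supNorm {F : Type*} [NormedAddCommGroup F] (Γ : Set Plane) (f : Plane → F) : ℝ≥0∞ :=
  eLpNorm f ∞ ((Measure.hausdorffMeasure 1).restrict Γ)

/-- The scaling factor `‖f‖_{L^∞(Γ)} / ‖Φ_k(·, z)‖_{L^∞(Γ)}`. -/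
def scaling {F : Type*} [NormedAddCommGroup F] (k : ℝ) (Γ : Set Plane) (z : Plane)
    (f : Plane → F) : ℝ :=
  (supNorm Γ f).toReal / (supNorm Γ (fun x => fundSol k x z)).toReal

/-! ### The phase retrieval system -/

/-- `A = (Y₀(kr) + H₀(kr)) / k²`, where `r = |x - z|` and `H₀(t) = i H₀⁽¹⁾(it)`; the quantity in
brackets is real, and the real part only turns it into an element of `ℝ`. -/
def coeffA (k : ℝ) (z x : Plane) : ℝ :=
  1 / k ^ 2 * (besselY0 ((k * dist x z : ℝ) : ℂ)
    + Complex.I * hankelH0 (Complex.I * ((k * dist x z : ℝ) : ℂ))).re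

/-- `B = - J₀(kr) / k²`, where `r = |x - z|`. -/
def coeffB (k : ℝ) (z x : Plane) : ℝ :=
  -(1 / k ^ 2) * (besselJ0 ((k * dist x z : ℝ) : ℂ)).re

/-- The right-hand side `(4/c) (q² - p²) - (c/16) (A² + B²)` built from the measured modulus `p` of
the field at `x`, the measured modulus `q` of the field with a point source at `z` added, and the
scaling factor `c`. -/
def rhs (k : ℝ) (z x : Plane) (c p q : ℝ) : ℝ :=
  4 / c * (q ^ 2 - p ^ 2) - c / 16 * (coeffA k z x ^ 2 + coeffB k z x ^ 2)

/-- `w` solves the phase retrieval system at the point `x`, with source points `z ℓ`, scaling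
factors `c ℓ` and measured moduli `p`, `q ℓ`. -/
def SolvesAt (k : ℝ) (z : Fin 2 → Plane) (x : Plane) (c : Fin 2 → ℝ) (p : ℝ) (q : Fin 2 → ℝ)
    (w : ℂ) : Prop :=
  ∀ l, coeffA k (z l) x * w.re + coeffB k (z l) x * w.im = rhs k (z l) x (c l) p (q l)

/-- `M = (1/2) (1.74 - 3/(2τ))`. -/
def constM (τ : ℝ) : ℝ := 1 / 2 * (1.74 - 3 / (2 * τ))

/-- `η_ε`, where `c₁`, `c₂` are the scaling factors of the exact field. -/
def eta (ε c₁ c₂ : ℝ) : ℝ :=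
  1 / (1 - ε) * (4 * (3 + ε) * (2 + ε) ^ 2 + 4 * (3 + ε) + 8) + 4 * (c₁ + c₂)

/-- `C_ε = √2 ε η_ε / M`. -/
def stabConst (τ ε c₁ c₂ : ℝ) : ℝ := √2 * ε * eta ε c₁ c₂ / constM τ

/-- `p` and `q ℓ` are measured moduli, with relative noise level `ε`, of the field `u` on `Γ` and
of the fields `u - c^ε_ℓ Φ_k(·, z_ℓ)`, where `c^ε_ℓ` is the scaling factor computed from `p`. -/
structure IsNoisyData (k ε : ℝ) (Γ : Set Plane) (z : Fin 2 → Plane) (u : Plane → ℂ)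
    (p : Plane → ℝ) (q : Fin 2 → Plane → ℝ) : Prop where
  nonneg_field : ∀ x ∈ Γ, 0 ≤ p x
  nonneg_aux : ∀ l, ∀ x ∈ Γ, 0 ≤ q l x
  noise_field : supNorm Γ (fun x => p x - ‖u x‖) ≤ ENNReal.ofReal ε * supNorm Γ u
  noise_aux : ∀ l,
    supNorm Γ (fun x => q l x - ‖u x - (scaling k Γ (z l) p : ℂ) * fundSol k x (z l)‖) ≤
      ENNReal.ofReal ε *
        supNorm Γ (fun x => u x - (scaling k Γ (z l) p : ℂ) * fundSol k x (z l))

end PhaseRetrieval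

end

noncomputable section

namespace PhaseRetrieval

/-! ### Entire power series -/

theorem summable_of_abs_le_div_factorial {a : ℕ → ℝ} {C : ℝ}
    (h : ∀ n, |a n| ≤ C / n.factorial) (y : ℝ) : Summable fun n => a n * y ^ n := by
  refine Summable.of_norm_bounded ((Real.summable_pow_div_factorial |y|).mul_left C) fun n => ?_
  rw [Real.norm_eq_abs, abs_mul, abs_pow]
  calc |a n| * |y| ^ n ≤ C / n.factorial * |y| ^ n := by gcongr; exact h n
    _ = _ := by ring

theorem hasDerivAt_tsum_mul_pow {a : ℕ → ℝ} {C : ℝ}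
    (h : ∀ n, |a n| ≤ C / n.factorial) (y : ℝ) :
    HasDerivAt (fun x => ∑' n, a n * x ^ n) (∑' n : ℕ, ((n : ℝ) + 1) * a (n + 1) * y ^ n) y := by
  set r := |y| + 1
  have hr : 0 < r := by positivity
  have hsum : Summable fun n : ℕ => C / n.factorial * (n * r ^ (n - 1)) := by
    rw [← summable_nat_add_iff 1]
    refine ((Real.summable_pow_div_factorial r).mul_left C).congr fun n => ?_
    have : (n.factorial : ℝ) ≠ 0 := by positivity
    rw [Nat.factorial_succ]
    push_cast
    field_simp
  have hbound : ∀ n : ℕ, ∀ x ∈ Metric.ball (0 : ℝ) r,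
      ‖a n * (n * x ^ (n - 1))‖ ≤ C / n.factorial * (n * r ^ (n - 1)) := by
    intro n x hx
    have hx' : |x| ≤ r := by simpa using (mem_ball_zero_iff.1 hx).le
    rw [Real.norm_eq_abs, abs_mul, abs_mul, abs_pow, Nat.abs_cast]
    exact mul_le_mul (h n) (by gcongr) (by positivity) ((abs_nonneg _).trans (h n))
  have hy : y ∈ Metric.ball (0 : ℝ) r := by simp [r]
  have key := hasDerivAt_tsum_of_isPreconnected hsum Metric.isOpen_ball
    (convex_ball (0 : ℝ) r).isPreconnected
    (g := fun n x => a n * x ^ n) (g' := fun n x => a n * (n * x ^ (n - 1)))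
    (fun n x _ => (hasDerivAt_pow n x).const_mul (a n)) hbound hy
    (summable_of_abs_le_div_factorial h y) hy
  refine key.congr_deriv ?_
  rw [(Summable.of_norm_bounded hsum fun n => hbound n y hy).tsum_eq_zero_add]
  simp only [Nat.cast_zero, zero_mul, mul_zero, zero_add, Nat.add_sub_cancel]
  refine tsum_congr fun n => ?_
  push_cast
  ring

theorem mul_tsum_succ_mul_pow {a : ℕ → ℝ} {C : ℝ}
    (h : ∀ n, |n * a n| ≤ C / n.factorial) (y : ℝ) :
    y * ∑' n : ℕ, ((n : ℝ) + 1) * a (n + 1) * y ^ n = ∑' n : ℕ, (n * a n) * y ^ n := by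
  rw [(summable_of_abs_le_div_factorial h y).tsum_eq_zero_add, ← tsum_mul_left]
  simp only [Nat.cast_zero, zero_mul, zero_add]
  refine tsum_congr fun n => ?_
  push_cast
  ring

/-! ### The two basic series -/

/-- Coefficients `1 / (n!)²`. -/
def coeffP (n : ℕ) : ℝ := 1 / (n.factorial : ℝ) ^ 2

/-- Coefficients `hₙ / (n!)²`. -/
def coeffQ (n : ℕ) : ℝ := (harmonic n : ℝ) / (n.factorial : ℝ) ^ 2

/-- `p(y) = ∑ yⁿ / (n!)²`. -/
def serP (y : ℝ) : ℝ := ∑' n, coeffP n * y ^ n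

/-- `q(y) = ∑ hₙ yⁿ / (n!)²`. -/
def serQ (y : ℝ) : ℝ := ∑' n, coeffQ n * y ^ n

/-- The derivative of `p`. -/
def serP' (y : ℝ) : ℝ := ∑' n : ℕ, ((n : ℝ) + 1) * coeffP (n + 1) * y ^ n

/-- The derivative of `q`. -/
def serQ' (y : ℝ) : ℝ := ∑' n : ℕ, ((n : ℝ) + 1) * coeffQ (n + 1) * y ^ n

theorem harmonic_nonneg (n : ℕ) : (0 : ℝ) ≤ (harmonic n : ℝ) := by
  have : (0 : ℚ) ≤ harmonic n := Finset.sum_nonneg fun i _ => by positivity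
  exact_mod_cast this

theorem harmonic_succ_cast (n : ℕ) :
    (harmonic (n + 1) : ℝ) = (harmonic n : ℝ) + 1 / ((n : ℝ) + 1) := by
  rw [harmonic_succ]
  push_cast
  ring

theorem harmonic_le_self (n : ℕ) : (harmonic n : ℝ) ≤ n := by
  induction n with
  | zero => simp
  | succ n ih =>
    rw [harmonic_succ_cast]
    push_cast
    have : 1 / ((n : ℝ) + 1) ≤ 1 := by
      rw [div_le_one (by positivity)]
      linarith [n.cast_nonneg (α := ℝ)]
    linarith

theorem sq_le_two_mul_factorial (n : ℕ) : n ^ 2 ≤ 2 * n.factorial := by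
  induction n with
  | zero => simp
  | succ n ih =>
    rw [Nat.factorial_succ]
    rcases n with _ | _ | _ | n
    · simp
    · simp [Nat.factorial]
    · simp [Nat.factorial]
    · nlinarith

theorem abs_div_factorial_sq_le {n : ℕ} {b : ℝ} (h : |b| ≤ (n : ℝ) ^ 2 ∨ |b| ≤ 1) :
    |b / (n.factorial : ℝ) ^ 2| ≤ 2 / n.factorial := by
  have h1 : (1 : ℝ) ≤ n.factorial := by exact_mod_cast Nat.succ_le_of_lt n.factorial_pos
  have h2 : ((n : ℝ)) ^ 2 ≤ 2 * n.factorial := by exact_mod_cast sq_le_two_mul_factorial n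
  have h3 : |b| ≤ 2 * n.factorial := by rcases h with h | h <;> linarith
  rw [abs_div, abs_of_nonneg (by positivity : (0 : ℝ) ≤ (n.factorial : ℝ) ^ 2),
    div_le_div_iff₀ (by positivity) (by positivity)]
  nlinarith

theorem coeffP_bound (n : ℕ) : |coeffP n| ≤ 2 / n.factorial :=
  abs_div_factorial_sq_le (Or.inr (by simp))

theorem natCast_le_sq (n : ℕ) : (n : ℝ) ≤ (n : ℝ) ^ 2 := by
  exact_mod_cast Nat.le_self_pow (by norm_num) n

theorem coeffQ_bound (n : ℕ) : |coeffQ n| ≤ 2 / n.factorial := by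
  refine abs_div_factorial_sq_le (Or.inl ?_)
  rw [abs_of_nonneg (harmonic_nonneg n)]
  exact (harmonic_le_self n).trans (natCast_le_sq n)

theorem mul_coeffP_bound (n : ℕ) : |n * coeffP n| ≤ 2 / n.factorial := by
  rw [coeffP, mul_one_div]
  refine abs_div_factorial_sq_le (Or.inl ?_)
  rw [Nat.abs_cast]
  exact natCast_le_sq n

theorem mul_coeffQ_bound (n : ℕ) : |n * coeffQ n| ≤ 2 / n.factorial := by
  rw [coeffQ, ← mul_div_assoc]
  refine abs_div_factorial_sq_le (Or.inl ?_)
  rw [abs_of_nonneg (mul_nonneg n.cast_nonneg (harmonic_nonneg n)), sq]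
  exact mul_le_mul_of_nonneg_left (harmonic_le_self n) n.cast_nonneg

theorem sq_mul_coeffP_succ (n : ℕ) : ((n : ℝ) + 1) ^ 2 * coeffP (n + 1) = coeffP n := by
  have : (n.factorial : ℝ) ≠ 0 := by positivity
  rw [coeffP, coeffP, Nat.factorial_succ]
  push_cast
  field_simp

theorem sq_mul_coeffQ_succ (n : ℕ) :
    ((n : ℝ) + 1) ^ 2 * coeffQ (n + 1) = coeffQ n + ((n : ℝ) + 1) * coeffP (n + 1) := by
  have : (n.factorial : ℝ) ≠ 0 := by positivity
  rw [coeffP, coeffQ, coeffQ, harmonic_succ_cast, Nat.factorial_succ]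
  push_cast
  field_simp

theorem hasDerivAt_serP (y : ℝ) : HasDerivAt serP (serP' y) y :=
  hasDerivAt_tsum_mul_pow coeffP_bound y

theorem hasDerivAt_serQ (y : ℝ) : HasDerivAt serQ (serQ' y) y :=
  hasDerivAt_tsum_mul_pow coeffQ_bound y

theorem mul_serP' (y : ℝ) : y * serP' y = ∑' n : ℕ, (n * coeffP n) * y ^ n :=
  mul_tsum_succ_mul_pow mul_coeffP_bound y

theorem mul_serQ' (y : ℝ) : y * serQ' y = ∑' n : ℕ, (n * coeffQ n) * y ^ n :=
  mul_tsum_succ_mul_pow mul_coeffQ_bound y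

theorem summable_serP (y : ℝ) : Summable fun n => coeffP n * y ^ n :=
  summable_of_abs_le_div_factorial coeffP_bound y

theorem summable_serQ (y : ℝ) : Summable fun n => coeffQ n * y ^ n :=
  summable_of_abs_le_div_factorial coeffQ_bound y

theorem summable_serP' (y : ℝ) :
    Summable fun n : ℕ => ((n : ℝ) + 1) * coeffP (n + 1) * y ^ n := by
  refine summable_of_abs_le_div_factorial (C := 2) (fun n => ?_) y
  have h := mul_coeffP_bound (n + 1)
  push_cast at h
  refine h.trans ?_
  gcongr
  exact Nat.le_succ n

theorem hasDerivAt_mul_serP' (y : ℝ) : HasDerivAt (fun y => y * serP' y) (serP y) y := by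
  simp_rw [mul_serP']
  convert hasDerivAt_tsum_mul_pow mul_coeffP_bound y using 1
  refine tsum_congr fun n => ?_
  rw [← sq_mul_coeffP_succ]
  push_cast
  ring

theorem hasDerivAt_mul_serQ' (y : ℝ) :
    HasDerivAt (fun y => y * serQ' y) (serQ y + serP' y) y := by
  simp_rw [mul_serQ']
  convert hasDerivAt_tsum_mul_pow mul_coeffQ_bound y using 1
  rw [serQ, serP', ← (summable_serQ y).tsum_add (summable_serP' y)]
  refine tsum_congr fun n => ?_
  rw [← add_mul, ← sq_mul_coeffQ_succ]
  push_cast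
  ring

theorem tsum_mul_zero_pow (a : ℕ → ℝ) : ∑' n, a n * (0 : ℝ) ^ n = a 0 := by
  rw [tsum_eq_single 0 (fun n hn => by simp [hn])]
  simp

theorem serP_zero : serP 0 = 1 := by
  rw [serP, tsum_mul_zero_pow]
  simp [coeffP]

theorem wronskian_series (y : ℝ) :
    serP y ^ 2 + 2 * ((y * serP' y) * serQ y - serP y * (y * serQ' y)) = 1 := by
  have hd : ∀ y, HasDerivAt (fun y => serP y ^ 2 +
      2 * ((y * serP' y) * serQ y - serP y * (y * serQ' y))) 0 y := by
    intro y
    have := ((hasDerivAt_serP y).pow 2).add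
      ((((hasDerivAt_mul_serP' y).mul (hasDerivAt_serQ y)).sub
        ((hasDerivAt_serP y).mul (hasDerivAt_mul_serQ' y))).const_mul 2)
    refine this.congr_deriv ?_
    push_cast
    ring
  have := is_const_of_deriv_eq_zero (fun y => (hd y).differentiableAt) (fun y => (hd y).deriv) y 0
  simpa [serP_zero] using this

/-- Error bound for the fourth partial sum of a power series. -/
theorem abs_tsum_mul_pow_sub_le {a : ℕ → ℝ} {C y : ℝ} (ha : ∀ n, |a (n + 4)| ≤ C * (1 / 2) ^ n)
    (hy : |y| ≤ 1) (hs : Summable fun n => a n * y ^ n) :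
    |∑' n, a n * y ^ n - (a 0 + a 1 * y + a 2 * y ^ 2 + a 3 * y ^ 3)| ≤ 2 * C * y ^ 4 := by
  rw [← hs.sum_add_tsum_nat_add 4]
  simp only [Finset.sum_range_succ, Finset.sum_range_zero, pow_zero, pow_one, mul_one, zero_add,
    add_sub_cancel_left]
  have hg : HasSum (fun n : ℕ => C * y ^ 4 * (1 / 2 : ℝ) ^ n) (C * y ^ 4 * 2) :=
    hasSum_geometric_two.mul_left _
  have := tsum_of_norm_bounded hg (f := fun n => a (n + 4) * y ^ (n + 4)) fun n => by
    have h1 : |y| ^ n ≤ 1 := pow_le_one₀ (abs_nonneg y) hy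
    have h2 : |y| ^ 4 = y ^ 4 := Even.pow_abs (by decide) y
    rw [Real.norm_eq_abs, abs_mul, abs_pow, pow_add, h2]
    have h3 : 0 ≤ y ^ 4 := by positivity
    calc |a (n + 4)| * (|y| ^ n * y ^ 4) ≤ (C * (1 / 2) ^ n) * (1 * y ^ 4) := by
          gcongr
          · exact (abs_nonneg _).trans (ha n)
          · exact ha n
      _ = _ := by ring
  rw [Real.norm_eq_abs] at this
  linarith

theorem inv_factorial_sq_le (n : ℕ) :
    1 / ((n + 4).factorial : ℝ) ^ 2 * ((n : ℝ) + 4) ^ 2 ≤ 1 / 36 * (1 / 2) ^ n := by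
  have h := Nat.factorial_mul_pow_le_factorial (m := 3) (n := n)
  have h' : (6 : ℝ) * 4 ^ n ≤ (n + 3).factorial := by
    rw [add_comm]; exact_mod_cast h
  have h1 : ((n + 4).factorial : ℝ) = (n + 4) * (n + 3).factorial := by
    rw [Nat.factorial_succ]; push_cast; ring
  have h2 : (2 : ℝ) ^ n ≤ (4 ^ n) ^ 2 := by
    rw [← pow_mul, mul_comm, pow_mul]; gcongr; norm_num
  have h3 : 36 * (2 : ℝ) ^ n ≤ ((n + 3).factorial : ℝ) ^ 2 := by
    have : ((6 : ℝ) * 4 ^ n) ^ 2 ≤ ((n + 3).factorial : ℝ) ^ 2 := by gcongr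
    nlinarith
  rw [h1, one_div_pow, one_div_mul_one_div, mul_pow]
  have : 1 / (((n : ℝ) + 4) ^ 2 * ((n + 3).factorial : ℝ) ^ 2) * ((n : ℝ) + 4) ^ 2
      = 1 / ((n + 3).factorial : ℝ) ^ 2 := by
    have : (((n + 3).factorial : ℝ)) ≠ 0 := by positivity
    field_simp
  rw [this]
  exact one_div_le_one_div_of_le (by positivity) h3

theorem abs_coeff_tail_le {n : ℕ} {b c : ℝ} (hc : 0 ≤ c) (h : |b| ≤ c * ((n : ℝ) + 4) ^ 2) :
    |b / ((n + 4).factorial : ℝ) ^ 2| ≤ c / 36 * (1 / 2) ^ n := by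
  rw [abs_div, abs_of_nonneg (by positivity : (0 : ℝ) ≤ ((n + 4).factorial : ℝ) ^ 2)]
  calc |b| / ((n + 4).factorial : ℝ) ^ 2 ≤ c * ((n : ℝ) + 4) ^ 2 / ((n + 4).factorial : ℝ) ^ 2 := by
        gcongr
    _ = c * (1 / ((n + 4).factorial : ℝ) ^ 2 * ((n : ℝ) + 4) ^ 2) := by ring
    _ ≤ c * (1 / 36 * (1 / 2) ^ n) := mul_le_mul_of_nonneg_left (inv_factorial_sq_le n) hc
    _ = _ := by ring

theorem coeffP_values :
    coeffP 0 = 1 ∧ coeffP 1 = 1 ∧ coeffP 2 = 1 / 4 ∧ coeffP 3 = 1 / 36 := by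
  norm_num [coeffP, Nat.factorial]

theorem coeffQ_values :
    coeffQ 0 = 0 ∧ coeffQ 1 = 1 ∧ coeffQ 2 = 3 / 8 ∧ coeffQ 3 = 11 / 216 := by
  norm_num [coeffQ, Nat.factorial, harmonic, Finset.sum_range_succ]

theorem harmonic_tail_le (n : ℕ) : |(harmonic (n + 4) : ℝ)| ≤ 1 / 4 * ((n : ℝ) + 4) ^ 2 := by
  rw [abs_of_nonneg (harmonic_nonneg _)]
  refine (harmonic_le_self _).trans ?_
  push_cast
  nlinarith [n.cast_nonneg (α := ℝ)]

theorem serP_approx {y : ℝ} (hy : |y| ≤ 1) :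
    |serP y - (1 + y + y ^ 2 / 4 + y ^ 3 / 36)| ≤ y ^ 4 / 288 := by
  have := abs_tsum_mul_pow_sub_le (a := coeffP) (C := 1 / 16 / 36) (fun n => by
    refine abs_coeff_tail_le (by norm_num) ?_
    rw [abs_one]
    nlinarith [n.cast_nonneg (α := ℝ)]) hy (summable_serP y)
  obtain ⟨e0, e1, e2, e3⟩ := coeffP_values
  simp only [e0, e1, e2, e3] at this
  rw [serP]
  rw [abs_le] at this ⊢
  constructor <;> linarith

theorem serQ_approx {y : ℝ} (hy : |y| ≤ 1) :
    |serQ y - (y + 3 / 8 * y ^ 2 + 11 / 216 * y ^ 3)| ≤ y ^ 4 / 72 := by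
  have := abs_tsum_mul_pow_sub_le (a := coeffQ) (C := 1 / 4 / 36) (fun n =>
    abs_coeff_tail_le (by norm_num) (harmonic_tail_le n)) hy (summable_serQ y)
  obtain ⟨e0, e1, e2, e3⟩ := coeffQ_values
  simp only [e0, e1, e2, e3] at this
  rw [serQ]
  rw [abs_le] at this ⊢
  constructor <;> linarith

theorem mul_serP'_approx {y : ℝ} (hy : |y| ≤ 1) :
    |y * serP' y - (y + y ^ 2 / 2 + y ^ 3 / 12)| ≤ y ^ 4 / 72 := by
  have := abs_tsum_mul_pow_sub_le (a := fun n => n * coeffP n) (C := 1 / 4 / 36) (fun n => by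
    simp only [coeffP, mul_one_div]
    refine abs_coeff_tail_le (by norm_num) ?_
    rw [Nat.abs_cast]
    push_cast
    nlinarith [n.cast_nonneg (α := ℝ)]) hy (summable_of_abs_le_div_factorial mul_coeffP_bound y)
  obtain ⟨e0, e1, e2, e3⟩ := coeffP_values
  simp only [e0, e1, e2, e3, Nat.cast_zero, Nat.cast_one, Nat.cast_ofNat] at this
  rw [mul_serP']
  rw [abs_le] at this ⊢
  constructor <;> linarith

theorem mul_serQ'_approx {y : ℝ} (hy : |y| ≤ 1) :
    |y * serQ' y - (y + 3 / 4 * y ^ 2 + 11 / 72 * y ^ 3)| ≤ y ^ 4 / 18 := by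
  have := abs_tsum_mul_pow_sub_le (a := fun n => n * coeffQ n) (C := 1 / 36) (fun n => by
    simp only [coeffQ, ← mul_div_assoc]
    refine abs_coeff_tail_le (by norm_num) ?_
    rw [abs_of_nonneg (mul_nonneg (Nat.cast_nonneg _) (harmonic_nonneg _)), one_mul, sq]
    have := harmonic_le_self (n + 4)
    push_cast at this ⊢
    gcongr) hy (summable_of_abs_le_div_factorial mul_coeffQ_bound y)
  obtain ⟨e0, e1, e2, e3⟩ := coeffQ_values
  simp only [e0, e1, e2, e3, Nat.cast_zero, Nat.cast_one, Nat.cast_ofNat] at this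
  rw [mul_serQ']
  rw [abs_le] at this ⊢
  constructor <;> linarith

/-! ### Real cylinder functions

For `σ = -1` these are `J₀` and `(π/2) Y₀`; for `σ = 1` they are `I₀` and `-K₀`. -/

/-- The regular solution of `(t w')' = σ t w`. -/
def regSol (σ t : ℝ) : ℝ := serP (σ * t ^ 2 / 4)

/-- `t` times the derivative of `regSol σ`. -/
def regSol' (σ t : ℝ) : ℝ := 2 * (σ * t ^ 2 / 4 * serP' (σ * t ^ 2 / 4))

/-- The logarithmic solution of `(t w')' = σ t w`. -/
def logSol (σ t : ℝ) : ℝ :=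
  (log (t / 2) + eulerMascheroniConstant) * serP (σ * t ^ 2 / 4) - serQ (σ * t ^ 2 / 4)

/-- `t` times the derivative of `logSol σ`. -/
def logSol' (σ t : ℝ) : ℝ :=
  serP (σ * t ^ 2 / 4) + (log (t / 2) + eulerMascheroniConstant) * regSol' σ t
    - 2 * (σ * t ^ 2 / 4 * serQ' (σ * t ^ 2 / 4))

theorem hasDerivAt_sq_scaled (σ t : ℝ) :
    HasDerivAt (fun t : ℝ => σ * t ^ 2 / 4) (σ * t / 2) t := by
  refine (((hasDerivAt_pow 2 t).const_mul σ).div_const 4).congr_deriv ?_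
  push_cast
  ring

theorem hasDerivAt_regSol (σ : ℝ) {t : ℝ} (ht : 0 < t) :
    HasDerivAt (regSol σ) (regSol' σ t / t) t := by
  refine ((hasDerivAt_serP (σ * t ^ 2 / 4)).comp t (hasDerivAt_sq_scaled σ t)).congr_deriv ?_
  rw [regSol']
  field_simp
  ring

theorem hasDerivAt_regSol' (σ t : ℝ) :
    HasDerivAt (regSol' σ) (σ * t * regSol σ t) t := by
  refine (((hasDerivAt_mul_serP' (σ * t ^ 2 / 4)).comp t
    (hasDerivAt_sq_scaled σ t)).const_mul 2).congr_deriv ?_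
  rw [regSol]
  ring

theorem hasDerivAt_log_half {t : ℝ} (ht : 0 < t) :
    HasDerivAt (fun t : ℝ => log (t / 2) + eulerMascheroniConstant) (1 / t) t := by
  refine ((((hasDerivAt_id t).div_const 2).log (by simp; positivity)).add_const _).congr_deriv ?_
  simp only [id]
  field_simp

theorem hasDerivAt_logSol (σ : ℝ) {t : ℝ} (ht : 0 < t) :
    HasDerivAt (logSol σ) (logSol' σ t / t) t := by
  have h1 := hasDerivAt_log_half ht
  have h2 := (hasDerivAt_serP (σ * t ^ 2 / 4)).comp t (hasDerivAt_sq_scaled σ t)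
  have h3 := (hasDerivAt_serQ (σ * t ^ 2 / 4)).comp t (hasDerivAt_sq_scaled σ t)
  refine ((h1.mul h2).sub h3).congr_deriv ?_
  rw [logSol', regSol']
  simp only [Function.comp]
  field_simp
  ring

theorem hasDerivAt_logSol' (σ : ℝ) {t : ℝ} (ht : 0 < t) :
    HasDerivAt (logSol' σ) (σ * t * logSol σ t) t := by
  have h1 := hasDerivAt_log_half ht
  have h2 := (hasDerivAt_serP (σ * t ^ 2 / 4)).comp t (hasDerivAt_sq_scaled σ t)
  have h3 := ((hasDerivAt_mul_serQ' (σ * t ^ 2 / 4)).comp t (hasDerivAt_sq_scaled σ t)).const_mul 2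
  refine ((h2.add (h1.mul (hasDerivAt_regSol' σ t))).sub h3).congr_deriv ?_
  rw [logSol, regSol', regSol]
  field_simp
  ring

theorem wronskian (σ t : ℝ) :
    regSol σ t * logSol' σ t - regSol' σ t * logSol σ t = 1 := by
  rw [← wronskian_series (σ * t ^ 2 / 4), regSol, logSol', regSol', logSol]
  ring

/-! ### Relation with the complex Bessel functions -/

theorem besselJ0_eq {z : ℂ} {y : ℝ} (h : z ^ 2 / 4 = ((-y : ℝ) : ℂ)) : besselJ0 z = (serP y : ℂ) := by
  rw [besselJ0, serP, Complex.ofReal_tsum]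
  refine tsum_congr fun n => ?_
  rw [h, coeffP]
  push_cast
  rw [neg_pow (y : ℂ)]
  have : (-1 : ℂ) ^ n * (-1) ^ n = 1 := by rw [← mul_pow]; simp
  linear_combination ((n.factorial : ℂ) ^ 2)⁻¹ * (y : ℂ) ^ n * this

theorem besselY0_eq {z : ℂ} {y : ℝ} (h : z ^ 2 / 4 = ((-y : ℝ) : ℂ)) :
    besselY0 z = 2 / (π : ℂ) * ((Complex.log (z / 2) + (eulerMascheroniConstant : ℂ)) * (serP y : ℂ)
      - (serQ y : ℂ)) := by
  have hq : ∑' n : ℕ, (-1 : ℂ) ^ n * ((harmonic n : ℚ) : ℂ) / ((n.factorial : ℂ) ^ 2) *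
      (z ^ 2 / 4) ^ n = (serQ y : ℂ) := by
    rw [serQ, Complex.ofReal_tsum]
    refine tsum_congr fun n => ?_
    rw [h, coeffQ]
    push_cast
    rw [neg_pow (y : ℂ)]
    have : (-1 : ℂ) ^ n * (-1) ^ n = 1 := by rw [← mul_pow]; simp
    linear_combination (harmonic n : ℂ) * ((n.factorial : ℂ) ^ 2)⁻¹ * (y : ℂ) ^ n * this
  rw [besselY0, hq, besselJ0_eq h]
  ring

theorem besselJ0_ofReal (t : ℝ) : besselJ0 (t : ℂ) = (regSol (-1) t : ℂ) :=
  besselJ0_eq (by push_cast; ring)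

theorem besselY0_ofReal {t : ℝ} (ht : 0 < t) :
    besselY0 (t : ℂ) = ((2 / π * logSol (-1) t : ℝ) : ℂ) := by
  rw [besselY0_eq (y := -1 * t ^ 2 / 4) (by push_cast; ring), logSol]
  have : Complex.log ((t : ℂ) / 2) = ((log (t / 2) : ℝ) : ℂ) := by
    rw [Complex.ofReal_log (by positivity)]
    push_cast
    rfl
  rw [this]
  push_cast
  ring

theorem hankelH0_I_mul {t : ℝ} (ht : 0 < t) :
    hankelH0 (Complex.I * (t : ℂ)) = Complex.I * ((2 / π * logSol 1 t : ℝ) : ℂ) := by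
  have h : (Complex.I * (t : ℂ)) ^ 2 / 4 = ((-(1 * t ^ 2 / 4) : ℝ) : ℂ) := by
    rw [mul_pow, Complex.I_sq]; push_cast; ring
  have hl : Complex.log (Complex.I * (t : ℂ) / 2) = ((log (t / 2) : ℝ) : ℂ) + π / 2 * Complex.I := by
    have : Complex.I * (t : ℂ) / 2 = ((t / 2 : ℝ) : ℂ) * Complex.I := by push_cast; ring
    rw [this, Complex.log_ofReal_mul (by positivity) Complex.I_ne_zero, Complex.log_I]
  rw [hankelH0, besselJ0_eq h, besselY0_eq h, hl, logSol]
  have hpi : (π : ℂ) ≠ 0 := by exact_mod_cast Real.pi_ne_zero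
  push_cast
  field_simp
  ring_nf
  simp only [Complex.I_sq]
  ring

/-- `Y₀(t) + (2/π) K₀(t)`. -/
def sumYK (t : ℝ) : ℝ := 2 / π * (logSol (-1) t - logSol 1 t)

theorem coeffA_eq {k : ℝ} {z x : Plane} (h : 0 < k * dist x z) :
    coeffA k z x = 1 / k ^ 2 * sumYK (k * dist x z) := by
  rw [coeffA, besselY0_ofReal h, hankelH0_I_mul h, ← mul_assoc, Complex.I_mul_I, sumYK]
  congr 1
  rw [Complex.add_re, Complex.ofReal_re, neg_one_mul, Complex.neg_re, Complex.ofReal_re]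
  ring

theorem coeffB_eq (k : ℝ) (z x : Plane) :
    coeffB k z x = -(1 / k ^ 2 * regSol (-1) (k * dist x z)) := by
  rw [coeffB, besselJ0_ofReal, Complex.ofReal_re]
  ring

theorem fundSol_eq {k : ℝ} {z x : Plane} (h : 0 < k * dist x z) :
    fundSol k x z = -(1 / 8 : ℂ) * ((coeffA k z x : ℂ) + (coeffB k z x : ℂ) * Complex.I) := by
  rw [coeffA_eq h, coeffB_eq, fundSol, hankelH0_I_mul h, hankelH0, besselJ0_ofReal,
    besselY0_ofReal h, sumYK]
  push_cast
  have := Complex.I_mul_I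
  linear_combination (1 / (8 * (k : ℂ) ^ 2)) * (2 / (π : ℂ) * (logSol (-1) (k * dist x z) : ℂ)
    - 2 / (π : ℂ) * (logSol 1 (k * dist x z) : ℂ)) * this

/-! ### Decay of the Macdonald function -/

theorem serP_term_nonneg {x : ℝ} (hx : 0 ≤ x) (n : ℕ) : 0 ≤ coeffP n * x ^ n := by
  unfold coeffP; positivity

theorem one_add_le_serP {x : ℝ} (hx : 0 ≤ x) : 1 + x + x ^ 2 / 4 + x ^ 3 / 36 ≤ serP x := by
  have h := (summable_serP x).sum_le_tsum (Finset.range 4) fun n _ => serP_term_nonneg hx n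
  obtain ⟨e0, e1, e2, e3⟩ := coeffP_values
  simp only [Finset.sum_range_succ, Finset.sum_range_zero, e0, e1, e2, e3] at h
  rw [serP]
  linarith

theorem serP_sub_one_le_mul_serP' {x : ℝ} (hx : 0 ≤ x) : serP x - 1 ≤ x * serP' x := by
  rw [mul_serP', serP, (summable_serP x).tsum_eq_zero_add,
    (summable_of_abs_le_div_factorial mul_coeffP_bound x).tsum_eq_zero_add]
  simp only [coeffP_values.1, pow_zero, mul_one, Nat.cast_zero, zero_add,
    add_sub_cancel_left]
  refine ((summable_nat_add_iff 1).2 (summable_serP x)).tsum_le_tsum (fun n => ?_)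
    ((summable_nat_add_iff 1).2 (summable_of_abs_le_div_factorial mul_coeffP_bound x))
  rw [mul_assoc]
  refine le_mul_of_one_le_left (serP_term_nonneg hx _) ?_
  push_cast
  linarith [n.cast_nonneg (α := ℝ)]

theorem hasSum_sq_mul_coeffP (x : ℝ) :
    HasSum (fun n : ℕ => (n : ℝ) ^ 2 * (coeffP n * x ^ n)) (x * serP x) := by
  rw [← hasSum_nat_add_iff' 1]
  simp only [Finset.sum_range_one, Nat.cast_zero, ne_eq, OfNat.ofNat_ne_zero, not_false_eq_true,
    zero_pow, zero_mul, sub_zero]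
  refine ((summable_serP x).hasSum.mul_left x).congr_fun fun n => ?_
  rw [← sq_mul_coeffP_succ n]
  push_cast
  ring

theorem hasSum_inv_sq_mul_coeffP (x : ℝ) :
    HasSum (fun n : ℕ => x / ((n : ℝ) + 1) ^ 2 * (coeffP n * x ^ n)) (serP x - 1) := by
  have h := (hasSum_nat_add_iff' 1).2 (summable_serP x).hasSum
  simp only [Finset.sum_range_one, coeffP_values.1, pow_zero, mul_one] at h
  refine h.congr_fun fun n => ?_
  rw [← sq_mul_coeffP_succ n]
  field_simp
  ring

theorem harmonic_lt (n : ℕ) : (harmonic n : ℝ) < eulerMascheroniConstant + log (n + 1) := by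
  have := eulerMascheroniSeq_lt_eulerMascheroniConstant n
  rw [eulerMascheroniSeq] at this
  linarith

theorem lt_harmonic (n : ℕ) :
    eulerMascheroniConstant + log (n + 1) - 1 / ((n : ℝ) + 1) < harmonic n := by
  have := eulerMascheroniConstant_lt_eulerMascheroniSeq' (n + 1)
  rw [eulerMascheroniSeq', if_neg (Nat.succ_ne_zero n), harmonic_succ_cast] at this
  push_cast at this
  linarith

theorem abs_logSol_one_le {t : ℝ} (ht : 0 < t) : |logSol 1 t| ≤ 2 / t * regSol 1 t := by
  set r := t / 2 with hr
  have hr0 : 0 < r := by positivity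
  have hx : 1 * t ^ 2 / 4 = r ^ 2 := by rw [hr]; ring
  rw [logSol, regSol, hx, ← hr]
  set x := r ^ 2 with hxr
  have hx0 : 0 ≤ x := by positivity
  have hP : HasSum (fun n => coeffP n * x ^ n) (serP x) := (summable_serP x).hasSum
  have hQ : HasSum (fun n => coeffQ n * x ^ n) (serQ x) := (summable_serQ x).hasSum
  have hD : HasSum (fun n : ℕ => ((harmonic n : ℝ) - eulerMascheroniConstant - log r) *
      (coeffP n * x ^ n)) (serQ x - (log r + eulerMascheroniConstant) * serP x) := by
    refine (hQ.sub (hP.mul_left (log r + eulerMascheroniConstant))).congr_fun fun n => ?_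
    rw [coeffQ, coeffP]
    ring
  have hlog : ∀ n : ℕ, log ((n : ℝ) + 1) - log r = log (((n : ℝ) + 1) / r) := fun n =>
    (Real.log_div (by positivity) hr0.ne').symm
  have e2 : 2 / t = 1 / r := by rw [hr]; field_simp
  rw [e2, abs_le]
  constructor
  · have hU : HasSum (fun n : ℕ => (1 / 2 * ((n : ℝ) ^ 2 / x - 1) + 1 / r) * (coeffP n * x ^ n))
        (1 / r * serP x) := by
      have := ((hasSum_sq_mul_coeffP x).mul_left (1 / (2 * x))).add (hP.mul_left (1 / r - 1 / 2))
      have e : 1 / (2 * x) * (x * serP x) + (1 / r - 1 / 2) * serP x = 1 / r * serP x := by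
        have : x ≠ 0 := by positivity
        field_simp
        ring
      exact e ▸ this.congr_fun fun n => by ring
    have := hasSum_le (fun n => mul_le_mul_of_nonneg_right (?_ : _ ≤ _)
      (serP_term_nonneg hx0 n)) hD hU
    · linarith
    · have h1 := Real.log_le_sub_one_of_pos (x := ((n : ℝ) + 1) / r) (by positivity)
      have h2 := harmonic_lt n
      have h3 := hlog n
      have h4 : ((n : ℝ) + 1) / r - 1 ≤ 1 / 2 * ((n : ℝ) ^ 2 / x - 1) + 1 / r := by
        have : 0 ≤ 1 / 2 * ((n : ℝ) / r - 1) ^ 2 := by positivity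
        rw [hxr]
        have e : 1 / 2 * ((n : ℝ) ^ 2 / r ^ 2 - 1) + 1 / r - (((n : ℝ) + 1) / r - 1)
          = 1 / 2 * ((n : ℝ) / r - 1) ^ 2 := by field_simp; ring
        linarith
      linarith
  · have hL : HasSum (fun n : ℕ => (1 - (r + 1) / 2 * (1 / r * (x / ((n : ℝ) + 1) ^ 2) + 1 / r)) *
        (coeffP n * x ^ n)) (serP x - (r + 1) / 2 * (1 / r * (serP x - 1) + 1 / r * serP x)) := by
      have := hP.sub ((((hasSum_inv_sq_mul_coeffP x).mul_left (1 / r)).add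
        (hP.mul_left (1 / r))).mul_left ((r + 1) / 2))
      exact this.congr_fun fun n => by ring
    have := hasSum_le (fun n => mul_le_mul_of_nonneg_right (?_ : _ ≤ _)
      (serP_term_nonneg hx0 n)) hL hD
    · have e : serP x - (r + 1) / 2 * (1 / r * (serP x - 1) + 1 / r * serP x)
        = -(1 / r * serP x) + (r + 1) / (2 * r) := by field_simp; ring
      have : 0 ≤ (r + 1) / (2 * r) := by positivity
      linarith
    · have h1 := Real.one_sub_inv_le_log_of_pos (x := ((n : ℝ) + 1) / r) (by positivity)
      have h2 := lt_harmonic n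
      have h3 := hlog n
      have h4 : 1 - (r + 1) / 2 * (1 / r * (x / ((n : ℝ) + 1) ^ 2) + 1 / r) ≤
          1 - (((n : ℝ) + 1) / r)⁻¹ - 1 / ((n : ℝ) + 1) := by
        have : 0 ≤ (r + 1) / 2 * (1 / r) * (r / ((n : ℝ) + 1) - 1) ^ 2 := by positivity
        have e : (1 - (((n : ℝ) + 1) / r)⁻¹ - 1 / ((n : ℝ) + 1)) -
            (1 - (r + 1) / 2 * (1 / r * (x / ((n : ℝ) + 1) ^ 2) + 1 / r))
          = (r + 1) / 2 * (1 / r) * (r / ((n : ℝ) + 1) - 1) ^ 2 := by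
          rw [hxr, inv_div]; field_simp; ring
        linarith
      linarith

theorem one_add_le_regSol_one (t : ℝ) :
    1 + t ^ 2 / 4 + t ^ 4 / 64 + t ^ 6 / 2304 ≤ regSol 1 t := by
  have := one_add_le_serP (x := 1 * t ^ 2 / 4) (by positivity)
  rw [regSol]
  refine le_trans (le_of_eq ?_) this
  ring

theorem regSol_one_pos (t : ℝ) : 0 < regSol 1 t :=
  lt_of_lt_of_le (by positivity) (one_add_le_regSol_one t)

theorem hasDerivAt_logSol_div_regSol {t : ℝ} (ht : 0 < t) :
    HasDerivAt (fun t => logSol 1 t / regSol 1 t) (1 / (t * regSol 1 t ^ 2)) t := by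
  have hI := (regSol_one_pos t).ne'
  refine ((hasDerivAt_logSol 1 ht).div (hasDerivAt_regSol 1 ht) hI).congr_deriv ?_
  have := wronskian 1 t
  field_simp
  linarith

theorem tendsto_logSol_div_regSol :
    Filter.Tendsto (fun t => logSol 1 t / regSol 1 t) Filter.atTop (nhds 0) := by
  have h : Filter.Tendsto (fun t : ℝ => 2 / t) Filter.atTop (nhds 0) :=
    Filter.Tendsto.div_atTop tendsto_const_nhds Filter.tendsto_id
  refine squeeze_zero_norm' ?_ h
  filter_upwards [Filter.eventually_gt_atTop 0] with t ht
  rw [Real.norm_eq_abs, abs_div, abs_of_pos (regSol_one_pos t), div_le_iff₀ (regSol_one_pos t)]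
  exact abs_logSol_one_le ht

theorem logSol_one_nonpos {t : ℝ} (ht : 0 < t) : logSol 1 t ≤ 0 := by
  have hmono : MonotoneOn (fun t => logSol 1 t / regSol 1 t) (Ioi 0) := by
    refine monotoneOn_of_deriv_nonneg (convex_Ioi 0)
      (fun s hs => (hasDerivAt_logSol_div_regSol hs).continuousAt.continuousWithinAt)
      (fun s hs => ?_) (fun s hs => ?_)
    all_goals rw [interior_Ioi] at hs
    · exact (hasDerivAt_logSol_div_regSol hs).differentiableAt.differentiableWithinAt
    · rw [(hasDerivAt_logSol_div_regSol hs).deriv]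
      have : 0 < s := hs
      positivity
  have hle : logSol 1 t / regSol 1 t ≤ 0 := by
    refine ge_of_tendsto tendsto_logSol_div_regSol ?_
    filter_upwards [Filter.eventually_ge_atTop t] with s hs
    exact hmono ht (lt_of_lt_of_le ht hs) hs
  by_contra! h
  exact absurd hle (not_le.2 (div_pos h (regSol_one_pos t)))

theorem regSol_one_le_regSol' {t : ℝ} (ht : 2 ≤ t) : regSol 1 t ≤ regSol' 1 t := by
  have h1 := serP_sub_one_le_mul_serP' (x := 1 * t ^ 2 / 4) (by positivity)
  have h2 := one_add_le_serP (x := 1 * t ^ 2 / 4) (by positivity)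
  have h3 : 1 ≤ 1 * t ^ 2 / 4 := by nlinarith
  have h4 : 0 ≤ (1 * t ^ 2 / 4) ^ 2 / 4 + (1 * t ^ 2 / 4) ^ 3 / 36 := by positivity
  rw [regSol, regSol']
  linarith

theorem neg_logSol_one_le {t : ℝ} (ht : 2 ≤ t) : -logSol 1 t ≤ 1 / (2 * regSol 1 t) := by
  have hd : ∀ s : ℝ, 0 < s → HasDerivAt
      (fun t => logSol 1 t / regSol 1 t + 1 / 2 * (regSol 1 t ^ 2)⁻¹)
      ((regSol 1 s - regSol' 1 s) / (s * regSol 1 s ^ 3)) s := by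
    intro s hs
    have hI := (regSol_one_pos s).ne'
    refine ((hasDerivAt_logSol_div_regSol hs).add
      ((((hasDerivAt_regSol 1 hs).pow 2).inv (pow_ne_zero 2 hI)).const_mul (1 / 2))).congr_deriv ?_
    simp only [Pi.pow_apply]
    push_cast
    field_simp
    ring
  have hpos : ∀ s : ℝ, 2 ≤ s → 0 < s := fun s hs => by linarith
  have hanti : AntitoneOn (fun t => logSol 1 t / regSol 1 t + 1 / 2 * (regSol 1 t ^ 2)⁻¹)
      (Ici 2) := by
    refine antitoneOn_of_deriv_nonpos (convex_Ici 2)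
      (fun s hs => (hd s (hpos s hs)).continuousAt.continuousWithinAt)
      (fun s hs => ?_) (fun s hs => ?_)
    all_goals rw [interior_Ici] at hs
    · exact (hd s (hpos s (le_of_lt hs))).differentiableAt.differentiableWithinAt
    · rw [(hd s (hpos s (le_of_lt hs))).deriv]
      have h0 := hpos s (le_of_lt hs)
      have hI := regSol_one_pos s
      exact div_nonpos_of_nonpos_of_nonneg (by linarith [regSol_one_le_regSol' (le_of_lt hs)])
        (by positivity)
  have hlim : Filter.Tendsto (fun t => logSol 1 t / regSol 1 t + 1 / 2 * (regSol 1 t ^ 2)⁻¹)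
      Filter.atTop (nhds (0 + 1 / 2 * 0)) := by
    refine tendsto_logSol_div_regSol.add (Filter.Tendsto.const_mul _ ?_)
    refine Filter.Tendsto.inv_tendsto_atTop ?_
    refine Filter.tendsto_atTop_mono' _ ?_ Filter.tendsto_id
    filter_upwards [Filter.eventually_ge_atTop 2] with s hs
    have h1 := one_add_le_regSol_one s
    have h2 : 0 ≤ s ^ 4 / 64 + s ^ 6 / 2304 := by positivity
    simp only [id]
    nlinarith [sq_nonneg (s - 2)]
  have hge := le_of_tendsto hlim (by
    filter_upwards [Filter.eventually_ge_atTop t] with s hs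
    exact hanti ht (le_trans ht hs) hs)
  have hI := regSol_one_pos t
  have e : logSol 1 t / regSol 1 t + 1 / 2 * (regSol 1 t ^ 2)⁻¹
      = (logSol 1 t + 1 / (2 * regSol 1 t)) / regSol 1 t := by
    field_simp
  simp only [mul_zero, add_zero, e] at hge
  have := mul_nonneg hge hI.le
  rw [div_mul_cancel₀ _ hI.ne'] at this
  linarith

/-- The Macdonald part of the fundamental solution is negligible for `t ≥ 7.85`. -/
theorem sqrt_mul_abs_logSol_one_le {t : ℝ} (ht : 7.85 ≤ t) :
    |√t * (2 / π * logSol 1 t)| ≤ 1 / 50 := by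
  have h0 : 0 < t := by linarith
  have h1 := logSol_one_nonpos h0
  have h2 := neg_logSol_one_le (show (2 : ℝ) ≤ t by linarith)
  have hI := one_add_le_regSol_one t
  have h3 : 16 * t ≤ regSol 1 t := by
    have h5 : (400 : ℝ) ≤ t ^ 3 := by
      have : (7.85 : ℝ) ^ 3 ≤ t ^ 3 := by gcongr
      linarith
    have h4 : 400 * t ≤ t ^ 4 := by
      rw [show t ^ 4 = t ^ 3 * t by ring]
      gcongr
    have h6 : 160000 ≤ t ^ 6 := by
      rw [show t ^ 6 = t ^ 3 * t ^ 3 by ring]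
      nlinarith
    have h7 : 61 ≤ t ^ 2 := by nlinarith
    nlinarith
  have h8 : √t ≤ t := Real.sqrt_le_iff.2 ⟨h0.le, by nlinarith⟩
  have h9 : 2 / π ≤ 0.64 := by
    rw [div_le_iff₀ Real.pi_pos]
    linarith [Real.pi_gt_d2]
  have h10 : -logSol 1 t ≤ 1 / (32 * t) := by
    refine h2.trans (one_div_le_one_div_of_le (by positivity) (by linarith))
  rw [abs_mul, abs_mul, abs_of_nonneg (Real.sqrt_nonneg t), abs_of_nonpos h1,
    abs_of_pos (by positivity : 0 < 2 / π)]
  calc √t * (2 / π * -logSol 1 t) ≤ t * (0.64 * (1 / (32 * t))) := by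
        have := neg_nonneg.2 h1
        gcongr
    _ = 1 / 50 := by field_simp; norm_num

/-! ### The Liouville normal form of Bessel's equation -/

/-- `√t J₀(t)`. -/
def amplJ (t : ℝ) : ℝ := √t * regSol (-1) t

/-- The derivative of `amplJ`. -/
def amplJ' (t : ℝ) : ℝ := (regSol (-1) t / 2 + regSol' (-1) t) / √t

/-- `√t Y₀(t)`. -/
def amplY (t : ℝ) : ℝ := √t * (2 / π * logSol (-1) t)

/-- The derivative of `amplY`. -/
def amplY' (t : ℝ) : ℝ := (2 / π * logSol (-1) t / 2 + 2 / π * logSol' (-1) t) / √t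

theorem hasDerivAt_sqrt_mul {u : ℝ → ℝ} {v t : ℝ} (ht : 0 < t) (hu : HasDerivAt u (v / t) t) :
    HasDerivAt (fun t => √t * u t) ((u t / 2 + v) / √t) t := by
  refine ((Real.hasDerivAt_sqrt ht.ne').mul hu).congr_deriv ?_
  have hs := Real.sqrt_pos.2 ht
  obtain ⟨s, hs0, hst⟩ : ∃ s : ℝ, 0 < s ∧ s ^ 2 = t := ⟨√t, hs, Real.sq_sqrt ht.le⟩
  rw [← hst, Real.sqrt_sq hs0.le]
  field_simp

theorem hasDerivAt_div_sqrt {u v : ℝ → ℝ} {t : ℝ} (ht : 0 < t) (hu : HasDerivAt u (v t / t) t)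
    (hv : HasDerivAt v (-1 * t * u t) t) :
    HasDerivAt (fun t => (u t / 2 + v t) / √t) (-(1 + 1 / (4 * t ^ 2)) * (√t * u t)) t := by
  have hs := Real.sqrt_pos.2 ht
  refine (((hu.div_const 2).add hv).div (Real.hasDerivAt_sqrt ht.ne') hs.ne').congr_deriv ?_
  simp only [Pi.add_apply]
  have h2 : √t ^ 2 = t := Real.sq_sqrt ht.le
  generalize √t = s at *
  subst h2
  field_simp
  ring

theorem hasDerivAt_amplJ {t : ℝ} (ht : 0 < t) : HasDerivAt amplJ (amplJ' t) t :=
  hasDerivAt_sqrt_mul ht (hasDerivAt_regSol (-1) ht)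

theorem hasDerivAt_amplJ' {t : ℝ} (ht : 0 < t) :
    HasDerivAt amplJ' (-(1 + 1 / (4 * t ^ 2)) * amplJ t) t :=
  hasDerivAt_div_sqrt ht (hasDerivAt_regSol (-1) ht) (hasDerivAt_regSol' (-1) t)

theorem hasDerivAt_amplY {t : ℝ} (ht : 0 < t) : HasDerivAt amplY (amplY' t) t :=
  hasDerivAt_sqrt_mul (u := fun t => 2 / π * logSol (-1) t) ht
    (((hasDerivAt_logSol (-1) ht).const_mul (2 / π)).congr_deriv (by ring))

theorem hasDerivAt_amplY' {t : ℝ} (ht : 0 < t) :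
    HasDerivAt amplY' (-(1 + 1 / (4 * t ^ 2)) * amplY t) t :=
  hasDerivAt_div_sqrt (u := fun t => 2 / π * logSol (-1) t)
    (v := fun t => 2 / π * logSol' (-1) t) ht
    (((hasDerivAt_logSol (-1) ht).const_mul (2 / π)).congr_deriv (by ring))
    (((hasDerivAt_logSol' (-1) ht).const_mul (2 / π)).congr_deriv (by ring))

theorem wronskian_ampl {t : ℝ} (ht : 0 < t) :
    amplJ t * amplY' t - amplJ' t * amplY t = 2 / π := by
  have hs := Real.sqrt_pos.2 ht
  have := wronskian (-1) t
  rw [amplJ, amplJ', amplY, amplY']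
  field_simp
  linear_combination 2 * this

/-- The energy of the pair of normalised Bessel functions. -/
def energy (t : ℝ) : ℝ := amplJ t ^ 2 + amplJ' t ^ 2 + (amplY t ^ 2 + amplY' t ^ 2)

theorem hasDerivAt_energy {t : ℝ} (ht : 0 < t) : HasDerivAt energy
    (-(1 / (2 * t ^ 2)) * (amplJ t * amplJ' t + amplY t * amplY' t)) t := by
  refine ((((hasDerivAt_amplJ ht).pow 2).add ((hasDerivAt_amplJ' ht).pow 2)).add
    (((hasDerivAt_amplY ht).pow 2).add ((hasDerivAt_amplY' ht).pow 2))).congr_deriv ?_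
  push_cast
  field_simp
  ring

theorem energy_mul_exp_antitoneOn :
    AntitoneOn (fun t => energy t * exp (1 / 4 * t⁻¹)) (Ioi 0) := by
  have hd : ∀ t : ℝ, 0 < t → HasDerivAt (fun t => energy t * exp (1 / 4 * t⁻¹))
      (-(1 / (4 * t ^ 2)) * ((amplJ t + amplJ' t) ^ 2 + (amplY t + amplY' t) ^ 2) *
        exp (1 / 4 * t⁻¹)) t := by
    intro t ht
    refine ((hasDerivAt_energy ht).mul
      (((hasDerivAt_inv ht.ne').const_mul (1 / 4)).exp)).congr_deriv ?_
    rw [energy]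
    field_simp
    ring
  refine antitoneOn_of_deriv_nonpos (convex_Ioi 0)
    (fun s hs => (hd s hs).continuousAt.continuousWithinAt) (fun s hs => ?_) (fun s hs => ?_)
  all_goals rw [interior_Ioi] at hs
  · exact (hd s hs).differentiableAt.differentiableWithinAt
  · rw [(hd s hs).deriv, neg_mul, neg_mul]
    exact neg_nonpos.2 (by positivity)

theorem energy_one_le : energy 1 ≤ 1.37 := by
  have hy : |(-1 / 4 : ℝ)| ≤ 1 := by norm_num [abs_le]
  have e : (-1 : ℝ) * 1 ^ 2 / 4 = -1 / 4 := by norm_num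
  have hp := serP_approx hy
  have hq := serQ_approx hy
  have hp' := mul_serP'_approx hy
  have hq' := mul_serQ'_approx hy
  have hl1 := Real.log_two_gt_d9
  have hl2 := Real.log_two_lt_d9
  have hg1 := Real.one_half_lt_eulerMascheroniConstant
  have hg2 := Real.eulerMascheroniConstant_lt_two_thirds
  have hl : log (1 / 2) = -log 2 := by rw [one_div, Real.log_inv]
  rw [energy, amplJ, amplJ', amplY, amplY', logSol, logSol', regSol', regSol, Real.sqrt_one, e, hl]
  generalize serP (-1 / 4) = p at *
  generalize -1 / 4 * serP' (-1 / 4) = p' at *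
  generalize serQ (-1 / 4) = q at *
  generalize -1 / 4 * serQ' (-1 / 4) = q' at *
  generalize hL : -log 2 + eulerMascheroniConstant = L at *
  have hL1 : -0.1932 ≤ L := by linarith
  have hL2 : L ≤ -0.0264 := by linarith
  rw [abs_le] at hp hq hp' hq'
  norm_num at hp hq hp' hq'
  have p1 : 0.765 ≤ p := by linarith
  have p2 : p ≤ 0.7653 := by linarith
  have r1 : -0.2202 ≤ p' := by linarith
  have r2 : p' ≤ -0.2199 := by linarith
  have q1 : -0.2275 ≤ q := by linarith
  have q2 : q ≤ -0.2271 := by linarith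
  have s1 : -0.206 ≤ q' := by linarith
  have s2 : q' ≤ -0.205 := by linarith
  have m1 : -L * p ≤ 0.1932 * 0.7653 := by gcongr; linarith
  have m2 : 0.0264 * 0.765 ≤ -L * p := by gcongr <;> linarith
  have m3 : -L * -p' ≤ 0.1932 * 0.2202 := by gcongr <;> linarith
  have m4 : 0 ≤ -L * -p' := mul_nonneg (by linarith) (by linarith)
  have z1 : 0 ≤ L * p - q := by linarith
  have z2 : L * p - q ≤ 0.21 := by linarith
  have w1 : 0 ≤ p + L * (2 * p') - 2 * q' := by linarith
  have w2 : p + L * (2 * p') - 2 * q' ≤ 1.265 := by linarith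
  have hpi : 2 / π ≤ 0.637 := by
    rw [div_le_iff₀ Real.pi_pos]
    linarith [Real.pi_gt_d4]
  have hpi0 : 0 < 2 / π := by positivity
  generalize L * p - q = Z at *
  generalize p + L * (2 * p') - 2 * q' = W at *
  generalize 2 / π = c at *
  have c3 : 0 ≤ c * Z := by positivity
  have c4 : 0 ≤ c * W := by positivity
  have c1 : c * Z ≤ 0.637 * 0.21 := by gcongr
  have c2 : c * W ≤ 0.637 * 1.265 := by gcongr
  have b1 : p ^ 2 ≤ 0.7653 ^ 2 := by gcongr
  have b2 : (p / 2 + 2 * p') ^ 2 ≤ 0.06 ^ 2 :=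
    sq_le_sq' (by linarith) (by linarith)
  have b3 : (c * Z) ^ 2 ≤ (0.637 * 0.21) ^ 2 := by gcongr
  have b4 : (c * Z / 2 + c * W) ^ 2 ≤ (0.637 * 0.21 / 2 + 0.637 * 1.265) ^ 2 := by gcongr
  norm_num at b1 b2 b3 b4
  simp only [one_mul, div_one]
  linarith

theorem energy_le {t : ℝ} (ht : 1 ≤ t) : energy t ≤ 1.78 := by
  have h := energy_mul_exp_antitoneOn (a := 1) (b := t) (by simp) (by simp; linarith) ht
  simp only [inv_one, mul_one] at h
  have h0 : 0 ≤ energy t := by rw [energy]; positivity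
  have h1 : 1 ≤ exp (1 / 4 * t⁻¹) := Real.one_le_exp (by positivity)
  have h2 : exp (1 / 4) ≤ 1.29 := by
    have h3 : exp (1 / 4) ^ 4 = exp 1 := by rw [← Real.exp_nat_mul]; norm_num
    by_contra! h4
    have : (1.29 : ℝ) ^ 4 < exp (1 / 4) ^ 4 := by gcongr
    rw [h3] at this
    linarith [Real.exp_one_lt_d9]
  have h5 := energy_one_le
  have h6 : energy 1 * exp (1 / 4) ≤ 1.37 * 1.29 := by gcongr
  nlinarith

theorem amplJ_sq_add_le {t : ℝ} (ht : 1 ≤ t) : amplJ t ^ 2 + amplY t ^ 2 ≤ 1.78 := by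
  have := energy_le ht
  rw [energy] at this
  nlinarith [sq_nonneg (amplJ' t), sq_nonneg (amplY' t)]

/-- The cross product of the normalised Bessel functions is close to a sine. -/
theorem cross_ampl_ge {s t : ℝ} (hs : 7.85 ≤ s) (h1 : 1.15 ≤ t - s) (h2 : t - s ≤ π / 2) :
    0.449 ≤ amplJ s * amplY t - amplJ t * amplY s := by
  set Q : ℝ → ℝ := fun r =>
    (amplJ s * amplY' r - amplJ' r * amplY s) * sin (t - r) +
      (amplJ s * amplY r - amplJ r * amplY s) * cos (t - r)
  have hd : ∀ r ∈ Icc s t, HasDerivWithinAt Q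
      (-(1 / (4 * r ^ 2)) * (amplJ s * amplY r - amplJ r * amplY s) * sin (t - r)) (Icc s t) r := by
    intro r hr
    have hr0 : 0 < r := by linarith [hr.1]
    have hsub : HasDerivAt (fun r => t - r) (-1) r := by
      simpa using (hasDerivAt_id r).const_sub t
    refine HasDerivAt.hasDerivWithinAt ?_
    refine (((((hasDerivAt_amplY' hr0).const_mul (amplJ s)).sub
      ((hasDerivAt_amplJ' hr0).mul_const (amplY s))).mul hsub.sin).add
      ((((hasDerivAt_amplY hr0).const_mul (amplJ s)).sub
      ((hasDerivAt_amplJ hr0).mul_const (amplY s))).mul hsub.cos)).congr_deriv ?_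
    simp only [Pi.sub_apply]
    ring
  have hbound : ∀ r ∈ Icc s t,
      ‖-(1 / (4 * r ^ 2)) * (amplJ s * amplY r - amplJ r * amplY s) * sin (t - r)‖ ≤ 0.00723 := by
    intro r hr
    have hr1 : 1 ≤ r := by linarith [hr.1]
    have e1 := amplJ_sq_add_le (show 1 ≤ s by linarith)
    have e2 := amplJ_sq_add_le hr1
    have e3 : |amplJ s * amplY r - amplJ r * amplY s| ≤ 1.78 := by
      rw [abs_le]
      constructor
      · nlinarith [sq_nonneg (amplJ s + amplY r), sq_nonneg (amplJ r - amplY s)]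
      · nlinarith [sq_nonneg (amplJ s - amplY r), sq_nonneg (amplJ r + amplY s)]
    have e4 : 1 / (4 * r ^ 2) ≤ 1 / 246.4 := by
      refine one_div_le_one_div_of_le (by norm_num) ?_
      nlinarith [hr.1]
    rw [Real.norm_eq_abs, abs_mul, abs_mul, abs_neg, abs_of_pos (by positivity)]
    calc 1 / (4 * r ^ 2) * |amplJ s * amplY r - amplJ r * amplY s| * |sin (t - r)|
        ≤ 1 / 246.4 * 1.78 * 1 := by
          gcongr
          exact Real.abs_sin_le_one _
      _ ≤ _ := by norm_num
  have hst : s ≤ t := by linarith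
  have hmv := (convex_Icc s t).norm_image_sub_le_of_norm_hasDerivWithin_le hd hbound
    (left_mem_Icc.2 hst) (right_mem_Icc.2 hst)
  have hQt : Q t = amplJ s * amplY t - amplJ t * amplY s := by simp [Q]
  have hQs : Q s = 2 / π * sin (t - s) := by
    rw [← wronskian_ampl (show 0 < s by linarith)]
    simp only [Q]
    ring
  have hsin := Real.mul_le_sin (show 0 ≤ t - s by linarith) h2
  have hpi : 0.6366 ≤ 2 / π := by
    rw [le_div_iff₀ Real.pi_pos]
    linarith [Real.pi_lt_d4]
  have h3 : 0.732 ≤ sin (t - s) := by nlinarith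
  rw [Real.norm_eq_abs, Real.norm_eq_abs, abs_of_nonneg (by linarith : 0 ≤ t - s)] at hmv
  have h4 := (abs_le.1 hmv).1
  have h5 : 0.6366 * 0.732 ≤ 2 / π * sin (t - s) := by gcongr
  rw [← hQt]
  have h6 := Real.pi_lt_d4
  rw [hQs] at h4
  nlinarith

/-! ### Consequences for large arguments -/

theorem sqrt_mul_sumYK (t : ℝ) :
    √t * sumYK t = amplY t - √t * (2 / π * logSol 1 t) := by
  rw [sumYK, amplY]
  ring

theorem abs_le_of_sq_add_sq_le {x y : ℝ} (h : x ^ 2 + y ^ 2 ≤ 1.78) : |x| ≤ 1.335 :=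
  abs_le_of_sq_le_sq (by nlinarith [sq_nonneg y]) (by norm_num)

theorem mul_sumYK_sq_add_le {t : ℝ} (ht : 7.85 ≤ t) :
    t * (sumYK t ^ 2 + regSol (-1) t ^ 2) ≤ 1.9 := by
  have h0 : 0 < t := by linarith
  have h1 := amplJ_sq_add_le (show 1 ≤ t by linarith)
  have h2 := sqrt_mul_abs_logSol_one_le ht
  have h3 := sqrt_mul_sumYK t
  have h4 : t * (sumYK t ^ 2 + regSol (-1) t ^ 2) = (√t * sumYK t) ^ 2 + amplJ t ^ 2 := by
    rw [amplJ, mul_pow, mul_pow, Real.sq_sqrt h0.le]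
    ring
  have h5 : |amplY t| ≤ 1.335 := abs_le_of_sq_add_sq_le (y := amplJ t) (by linarith)
  rw [h4, h3]
  generalize √t * (2 / π * logSol 1 t) = κ at *
  rw [abs_le] at h2 h5
  nlinarith

theorem cross_ge {s t : ℝ} (hs : 7.85 ≤ s) (h1 : 1.15 ≤ t - s) (h2 : t - s ≤ π / 2) :
    0.38 ≤ √s * √t * (regSol (-1) s * sumYK t - regSol (-1) t * sumYK s) := by
  have h3 := cross_ampl_ge hs h1 h2
  have hs1 := abs_le_of_sq_add_sq_le (amplJ_sq_add_le (show 1 ≤ s by linarith))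
  have ht1 := abs_le_of_sq_add_sq_le (amplJ_sq_add_le (show 1 ≤ t by linarith))
  have k1 := sqrt_mul_abs_logSol_one_le hs
  have k2 := sqrt_mul_abs_logSol_one_le (show 7.85 ≤ t by linarith)
  have e : √s * √t * (regSol (-1) s * sumYK t - regSol (-1) t * sumYK s)
      = amplJ s * amplY t - amplJ t * amplY s - (amplJ s * (√t * (2 / π * logSol 1 t))
        - amplJ t * (√s * (2 / π * logSol 1 s))) := by
    have e1 := sqrt_mul_sumYK s
    have e2 := sqrt_mul_sumYK t
    rw [amplJ, amplJ] at *
    linear_combination (√s * regSol (-1) s) * e2 - (√t * regSol (-1) t) * e1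
  rw [e]
  generalize √t * (2 / π * logSol 1 t) = κ at *
  generalize √s * (2 / π * logSol 1 s) = κ' at *
  have m1 : |amplJ s * κ| ≤ 1.335 * (1 / 50) := by
    rw [abs_mul]; gcongr
  have m2 : |amplJ t * κ'| ≤ 1.335 * (1 / 50) := by
    rw [abs_mul]; gcongr
  linarith [(abs_le.1 m1).2, (abs_le.1 m2).1]

/-! ### Small arguments -/

theorem sumYK_approx {t : ℝ} (h0 : 0 < t) (ht : t ^ 2 ≤ 4) :
    ∃ P Q : ℝ, |P - (t ^ 2 / 2 + t ^ 6 / 1152)| ≤ t ^ 8 / 36864 ∧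
      |Q - (t ^ 2 / 2 + 11 / 6912 * t ^ 6)| ≤ t ^ 8 / 9216 ∧
      sumYK t = 2 / π * (Q - (log (t / 2) + eulerMascheroniConstant) * P) := by
  have e1 : |1 * t ^ 2 / 4| ≤ 1 := by rw [abs_of_nonneg (by positivity)]; linarith
  have e2 : |-1 * t ^ 2 / 4| ≤ 1 := by
    rw [show -1 * t ^ 2 / 4 = -(1 * t ^ 2 / 4) by ring, abs_neg]; exact e1
  have p1 := abs_le.1 (serP_approx e1)
  have p2 := abs_le.1 (serP_approx e2)
  have q1 := abs_le.1 (serQ_approx e1)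
  have q2 := abs_le.1 (serQ_approx e2)
  refine ⟨serP (1 * t ^ 2 / 4) - serP (-1 * t ^ 2 / 4),
    serQ (1 * t ^ 2 / 4) - serQ (-1 * t ^ 2 / 4), ?_, ?_, ?_⟩
  · rw [abs_le]
    constructor <;> linarith [p1.1, p1.2, p2.1, p2.2]
  · rw [abs_le]
    constructor <;> linarith [q1.1, q1.2, q2.1, q2.2]
  · rw [sumYK, logSol, logSol]
    ring

theorem regSol_neg_approx {t : ℝ} (ht : t ^ 2 ≤ 4) :
    |regSol (-1) t - (1 - t ^ 2 / 4 + t ^ 4 / 64 - t ^ 6 / 2304)| ≤ t ^ 8 / 73728 := by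
  have e2 : |-1 * t ^ 2 / 4| ≤ 1 := by
    rw [show -1 * t ^ 2 / 4 = -(1 * t ^ 2 / 4) by ring, abs_neg, abs_of_nonneg (by positivity)]
    linarith
  have p := abs_le.1 (serP_approx e2)
  rw [regSol, abs_le]
  constructor <;> linarith [p.1, p.2]

theorem two_div_pi_bounds : 0.6366 ≤ 2 / π ∧ 2 / π ≤ 0.637 := by
  constructor
  · rw [le_div_iff₀ Real.pi_pos]; linarith [Real.pi_lt_d4]
  · rw [div_le_iff₀ Real.pi_pos]; linarith [Real.pi_gt_d4]

theorem bounds_near_inner_point {t : ℝ} (h0 : 0 < t) (h1 : 0.0986 ≤ t ^ 2) (h2 : t ^ 2 ≤ 0.1186) :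
    0 ≤ sumYK t ∧ sumYK t ≤ 0.1 ∧ 0.96 ≤ regSol (-1) t ∧ regSol (-1) t ≤ 1 := by
  obtain ⟨P, Q, hP, hQ, e⟩ := sumYK_approx h0 (by linarith)
  have hJ := abs_le.1 (regSol_neg_approx (show t ^ 2 ≤ 4 by linarith))
  rw [abs_le] at hP hQ
  have hg1 := Real.one_half_lt_eulerMascheroniConstant
  have hg2 := Real.eulerMascheroniConstant_lt_two_thirds
  have hl2 := Real.log_le_sub_one_of_pos (x := t / 2) (by positivity)
  have ht1 : 0.31 ≤ t := by nlinarith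
  have ht2 : t ≤ 0.35 := by nlinarith
  have hl1 : -2 ≤ log (t / 2) := by
    rw [Real.le_log_iff_exp_le (by positivity), Real.exp_neg]
    have h3 : exp 2 = exp 1 ^ 2 := by rw [← Real.exp_nat_mul]; norm_num
    have h4 : (2.7 : ℝ) ^ 2 ≤ exp 1 ^ 2 := by
      gcongr
      linarith [Real.exp_one_gt_d9]
    have h5 : (exp 2)⁻¹ ≤ 7.29⁻¹ := by
      rw [h3]
      gcongr
      linarith
    norm_num at h5
    linarith
  obtain ⟨c1, c2⟩ := two_div_pi_bounds
  have t4 : t ^ 4 ≤ 0.1186 ^ 2 := by rw [show t ^ 4 = (t ^ 2) ^ 2 by ring]; gcongr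
  have t6 : t ^ 6 ≤ 0.1186 ^ 3 := by rw [show t ^ 6 = (t ^ 2) ^ 3 by ring]; gcongr
  have t8 : t ^ 8 ≤ 0.1186 ^ 4 := by rw [show t ^ 8 = (t ^ 2) ^ 4 by ring]; gcongr
  have t4' : 0 ≤ t ^ 4 := by positivity
  have t6' : 0 ≤ t ^ 6 := by positivity
  norm_num at t4 t6 t8
  have P0 : 0 ≤ P := by linarith
  have P1 : P ≤ 0.0595 := by linarith
  have Q0 : 0 ≤ Q := by linarith
  have Q1 : Q ≤ 0.0595 := by linarith
  have L0 : 0 ≤ -(log (t / 2) + eulerMascheroniConstant) := by linarith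
  have L1 : -(log (t / 2) + eulerMascheroniConstant) ≤ 1.5 := by linarith
  have m0 := mul_nonneg L0 P0
  have m1 := mul_le_mul L1 P1 P0 (by norm_num)
  refine ⟨?_, ?_, by linarith, by linarith⟩
  · rw [e]
    refine mul_nonneg (by linarith) (by linarith)
  · rw [e]
    calc 2 / π * (Q - (log (t / 2) + eulerMascheroniConstant) * P) ≤ 0.637 * 0.14875 := by
          refine mul_le_mul c2 (by linarith) (by linarith) (by norm_num)
      _ ≤ 0.1 := by norm_num

theorem bounds_near_outer_point {t : ℝ} (h0 : 0 < t) (h1 : 2.407 ≤ t ^ 2) (h2 : t ^ 2 ≤ 2.4685) :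
    0.26 ≤ sumYK t ∧ sumYK t ≤ 0.81 ∧ 0 ≤ regSol (-1) t ∧ regSol (-1) t ≤ 0.49 := by
  obtain ⟨P, Q, hP, hQ, e⟩ := sumYK_approx h0 (by linarith)
  have hJ := abs_le.1 (regSol_neg_approx (show t ^ 2 ≤ 4 by linarith))
  rw [abs_le] at hP hQ
  have hg1 := Real.one_half_lt_eulerMascheroniConstant
  have hg2 := Real.eulerMascheroniConstant_lt_two_thirds
  have ht1 : 1.5 ≤ t := by nlinarith
  have ht2 : t ≤ 1.6 := by nlinarith
  have hl2 := Real.log_le_sub_one_of_pos (x := t / 2) (by positivity)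
  have hl1 := Real.one_sub_inv_le_log_of_pos (x := t / 2) (by positivity)
  have hinv : (t / 2)⁻¹ ≤ 0.75⁻¹ := by gcongr; linarith
  have hinv' : (0.75 : ℝ)⁻¹ ≤ 1.34 := by norm_num
  obtain ⟨c1, c2⟩ := two_div_pi_bounds
  have t4 : t ^ 4 ≤ 2.4685 ^ 2 := by rw [show t ^ 4 = (t ^ 2) ^ 2 by ring]; gcongr
  have t6 : t ^ 6 ≤ 2.4685 ^ 3 := by rw [show t ^ 6 = (t ^ 2) ^ 3 by ring]; gcongr
  have t8 : t ^ 8 ≤ 2.4685 ^ 4 := by rw [show t ^ 8 = (t ^ 2) ^ 4 by ring]; gcongr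
  have t4' : 0 ≤ t ^ 4 := by positivity
  have t6' : 2.407 ^ 3 ≤ t ^ 6 := by rw [show t ^ 6 = (t ^ 2) ^ 3 by ring]; gcongr
  norm_num at t4 t6 t8 t6'
  have P0 : 0 ≤ P := by linarith
  have L0 : 0 ≤ log (t / 2) + eulerMascheroniConstant := by linarith
  have L1 : log (t / 2) + eulerMascheroniConstant ≤ 2 / 3 := by linarith
  have m0 := mul_nonneg L0 P0
  have m1 := mul_le_mul_of_nonneg_right L1 P0
  refine ⟨?_, ?_, by linarith, by linarith⟩
  · rw [e]
    calc (0.26 : ℝ) ≤ 0.6366 * 0.409 := by norm_num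
      _ ≤ _ := mul_le_mul c1 (by linarith) (by norm_num) (by linarith)
  · rw [e]
    calc 2 / π * (Q - (log (t / 2) + eulerMascheroniConstant) * P) ≤ 0.637 * 1.27 := by
          refine mul_le_mul c2 (by linarith) (by linarith) (by norm_num)
      _ ≤ 0.81 := by norm_num

/-! ### The determinant of the system -/

theorem norm_fundSol_sq {k : ℝ} {z x : Plane} (h : 0 < k * dist x z) :
    ‖fundSol k x z‖ ^ 2 = (coeffA k z x ^ 2 + coeffB k z x ^ 2) / 64 := by
  rw [fundSol_eq h, norm_mul, mul_pow, ← Complex.normSq_eq_norm_sq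
    ((coeffA k z x : ℂ) + (coeffB k z x : ℂ) * Complex.I), Complex.normSq_add_mul_I]
  norm_num
  ring

theorem norm_fundSol_le {k c : ℝ} {z x : Plane} (hk : 0 < k) (h : 0 < k * dist x z) (hc : 0 ≤ c)
    (hb : sumYK (k * dist x z) ^ 2 + regSol (-1) (k * dist x z) ^ 2 ≤ c ^ 2) :
    ‖fundSol k x z‖ ≤ c / (8 * k ^ 2) := by
  refine le_of_sq_le_sq ?_ (by positivity)
  rw [norm_fundSol_sq h, coeffA_eq h, coeffB_eq]
  calc ((1 / k ^ 2 * sumYK (k * dist x z)) ^ 2 +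
        (-(1 / k ^ 2 * regSol (-1) (k * dist x z))) ^ 2) / 64
      = (sumYK (k * dist x z) ^ 2 + regSol (-1) (k * dist x z) ^ 2) / (64 * k ^ 4) := by
        field_simp
    _ ≤ c ^ 2 / (64 * k ^ 4) := by gcongr
    _ = _ := by field_simp; norm_num

theorem det_eq {k : ℝ} {z₁ z₂ x : Plane} (h₁ : 0 < k * dist x z₁) (h₂ : 0 < k * dist x z₂) :
    coeffA k z₁ x * coeffB k z₂ x - coeffA k z₂ x * coeffB k z₁ x =
      1 / k ^ 4 * (regSol (-1) (k * dist x z₁) * sumYK (k * dist x z₂) -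
        regSol (-1) (k * dist x z₂) * sumYK (k * dist x z₁)) := by
  rw [coeffA_eq h₁, coeffA_eq h₂, coeffB_eq, coeffB_eq]
  ring

theorem dist_polar_sq (R ρ θ φ : ℝ) :
    dist (polar R θ) (polar ρ φ) ^ 2 = R ^ 2 + ρ ^ 2 - 2 * R * ρ * cos (θ - φ) := by
  rw [EuclideanSpace.dist_eq, Real.sq_sqrt (Finset.sum_nonneg fun i _ => sq_nonneg _)]
  simp only [Fin.sum_univ_two, polar, Real.dist_eq, sq_abs, PiLp.toLp_apply,
    Matrix.cons_val_zero, Matrix.cons_val_one]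
  rw [Real.cos_sub]
  linear_combination R ^ 2 * Real.sin_sq_add_cos_sq θ + ρ ^ 2 * Real.sin_sq_add_cos_sq φ

theorem cos_ge_of_abs_le {θ : ℝ} {m : ℕ} (hm : 10 ≤ m) (h : |θ| ≤ π / m) : 0.95 ≤ cos θ := by
  have hm' : (10 : ℝ) ≤ m := by exact_mod_cast hm
  have h1 : |θ| ≤ 0.31416 := by
    refine h.trans ?_
    rw [div_le_iff₀ (by linarith)]
    nlinarith [Real.pi_lt_d4]
  have h2 := Real.one_sub_sq_div_two_le_cos (x := θ)
  have h3 : θ ^ 2 ≤ 0.31416 ^ 2 := sq_le_sq' (by linarith [(abs_le.1 h1).1]) (abs_le.1 h1).2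
  norm_num at h3
  linarith

/-- A point of the arc, seen from the source points. -/
theorem exists_cos_of_mem_arc {a τ k : ℝ} {m j : ℕ} (hm : 10 ≤ m) {x : Plane}
    (hx : x ∈ arc (radius a τ k) m j) :
    ∃ c : ℝ, 0.95 ≤ c ∧ c ≤ 1 ∧ ∀ l, (k * dist x (sourcePoint a τ k m j l)) ^ 2 =
      (k * radius a τ k) ^ 2 + (ratio a τ k l * (k * radius a τ k)) ^ 2
        - 2 * (k * radius a τ k) * (ratio a τ k l * (k * radius a τ k)) * c := by
  obtain ⟨θ, hθ, rfl⟩ := hx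
  have hm0 : (0 : ℝ) < m := by exact_mod_cast lt_of_lt_of_le (by norm_num) hm
  refine ⟨cos (θ - gridAngle m (2 * j - 1)), cos_ge_of_abs_le hm ?_, Real.cos_le_one _, fun l => ?_⟩
  · have h1 := hθ.1
    have h2 := hθ.2
    simp only [gridAngle] at *
    push_cast at *
    have e1 : (2 * (j : ℝ) - 2) * π / m = (2 * (j : ℝ) - 1) * π / m - π / m := by ring
    have e2 : (2 * (j : ℝ)) * π / m = (2 * (j : ℝ) - 1) * π / m + π / m := by ring
    rw [abs_le]
    constructor <;> linarith
  · rw [mul_pow, sourcePoint, dist_polar_sq]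
    ring

theorem geometry_large {X c s t : ℝ} (hX : 6 * π ≤ X) (hc : 0.95 ≤ c) (hc' : c ≤ 1) (hs : 0 ≤ s)
    (ht : 0 ≤ t)
    (es : s ^ 2 = X ^ 2 + (X / 2) ^ 2 - 2 * X * (X / 2) * c)
    (et : t ^ 2 = X ^ 2 + (X / 2 + π / 2) ^ 2 - 2 * X * (X / 2 + π / 2) * c) :
    X / 2 ≤ s ∧ s ≤ 1.05 ^ 2 * (X / 2) ∧ 7.85 ≤ X / 2 - π / 2 ∧ X / 2 - π / 2 ≤ t ∧
      t ≤ 1.08 ^ 2 * (X / 2 - π / 2) ∧ 1.15 ≤ s - t ∧ s - t ≤ π / 2 := by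
  have hp1 := Real.pi_gt_d4
  have hp2 := Real.pi_lt_d4
  have hX0 : 0 < X := by linarith
  have a1 : 0 ≤ X * X * (1 - c) := by have := sub_nonneg.2 hc'; positivity
  have a2 : X * X * (1 - c) ≤ X * X * 0.05 := by gcongr; linarith
  have a3 : 0 ≤ X * (π * (1 - c)) := by have := sub_nonneg.2 hc'; positivity
  have a4 : X * (π * (1 - c)) ≤ X * (X / 6 * 0.05) := by
    gcongr <;> linarith
  have hsX : s ≤ 0.55 * X := le_of_sq_le_sq (by nlinarith) (by positivity)
  have hd : X / 2 - π / 2 ≥ 5 / 12 * X := by linarith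
  have b1 : t ^ 2 = (X / 2 - π / 2) ^ 2 + X * X * (1 - c) + X * (π * (1 - c)) := by
    rw [et]; ring
  have htlow : X / 2 - π / 2 ≤ t := le_of_sq_le_sq (by nlinarith) ht
  have htup : t ≤ 1.08 ^ 2 * (X / 2 - π / 2) := by
    refine le_of_sq_le_sq ?_ (by linarith)
    have : (5 / 12 * X) ^ 2 ≤ (X / 2 - π / 2) ^ 2 := by gcongr
    nlinarith
  have htX : t ≤ 0.55 * X := by
    refine le_of_sq_le_sq ?_ (by positivity)
    have : π * π ≤ X / 6 * π := by gcongr; linarith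
    nlinarith
  have hdiff : (s - t) * (s + t) = π / 2 * (X * (2 * c - 1) - π / 2) := by
    linear_combination es - et
  have hslow : X / 2 ≤ s := le_of_sq_le_sq (by nlinarith) hs
  refine ⟨hslow, by linarith, by linarith, htlow, htup, ?_, ?_⟩
  · by_contra! hlt
    have h1 : 1.57 * (0.9 * X - X / 12) ≤ π / 2 * (X * (2 * c - 1) - π / 2) := by
      have : X * 0.9 ≤ X * (2 * c - 1) := by gcongr; linarith
      refine mul_le_mul (by linarith) (by linarith) (by linarith) (by linarith)
    have h2 : (s - t) * (s + t) ≤ 1.15 * (1.1 * X) :=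
      mul_le_mul hlt.le (by linarith) (by linarith) (by norm_num)
    linarith
  · have : s ≤ t + π / 2 := by
      refine le_of_sq_le_sq ?_ (by positivity)
      have h1 : (X / 2 - π / 2) * π ≤ t * π := by gcongr
      nlinarith
    linarith

/-- Uniform bounds for the fundamental solutions and the determinant on an arc. -/
def WellPosedOn (k : ℝ) (Γ : Set Plane) (z : Fin 2 → Plane) (b : Fin 2 → ℝ) : Prop :=
  ∀ x ∈ Γ, (∀ l, 0 < k * dist x (z l)) ∧ (∀ l, ‖fundSol k x (z l)‖ ≤ b l) ∧
    10 * (b 0 * b 1) ≤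
      |coeffA k (z 0) x * coeffB k (z 1) x - coeffA k (z 1) x * coeffB k (z 0) x|

theorem ratio_zero (a τ k : ℝ) : ratio a τ k 0 = 1 / 2 := rfl

theorem ratio_one (a τ k : ℝ) : ratio a τ k 1 =
    if k = smallWaveNumber a then -3 / 2 else 1 / 2 + π / (2 * k * radius a τ k) := rfl

theorem wellPosedOn_large {a τ k : ℝ} {m j : ℕ} (hm : 10 ≤ m) (hk : 0 < k)
    (hne : k ≠ smallWaveNumber a) (hX : 6 * π ≤ k * radius a τ k) :
    ∃ b : Fin 2 → ℝ, (∀ l, 0 < b l) ∧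
      WellPosedOn k (arc (radius a τ k) m j) (sourcePoint a τ k m j) b := by
  set X := k * radius a τ k with hXdef
  have hp1 := Real.pi_gt_d4
  have hp2 := Real.pi_lt_d4
  have hX0 : 0 < X := by linarith
  have hR0 : 0 < radius a τ k := (pos_iff_pos_of_mul_pos hX0).1 hk
  have hY0 : 0 < X / 2 - π / 2 := by linarith
  set d : Fin 2 → ℝ := ![X / 2, X / 2 - π / 2] with hd
  have hd0 : ∀ l, 7.85 ≤ d l := by
    intro l
    fin_cases l
    · simp [hd]; linarith
    · simp [hd]; linarith
  refine ⟨fun l => √(1.9 / d l) / (8 * k ^ 2), fun l => ?_, fun x hx => ?_⟩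
  · have := hd0 l
    have : 0 < d l := by linarith
    positivity
  obtain ⟨c, hc, hc', hdist⟩ := exists_cos_of_mem_arc hm hx
  have e0 := hdist 0
  have e1 := hdist 1
  rw [ratio_zero, ← hXdef] at e0
  rw [ratio_one, if_neg hne, ← hXdef,
    show (1 / 2 + π / (2 * k * radius a τ k)) * X = X / 2 + π / 2 by
      rw [hXdef]; field_simp] at e1
  rw [show 1 / 2 * X = X / 2 by ring] at e0
  obtain ⟨g1, g2, g3, g4, g5, g6, g7⟩ := geometry_large hX hc hc'
    (by positivity) (by positivity) e0 e1
  have hge : ∀ l, d l ≤ k * dist x (sourcePoint a τ k m j l) := by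
    intro l
    fin_cases l
    · simpa [hd] using g1
    · simpa [hd] using g4
  have hpos : ∀ l, 0 < k * dist x (sourcePoint a τ k m j l) := fun l => by
    linarith [hge l, hd0 l]
  refine ⟨hpos, fun l => ?_, ?_⟩
  · refine norm_fundSol_le hk (hpos l) (Real.sqrt_nonneg _) ?_
    have h1 := mul_sumYK_sq_add_le ((hd0 l).trans (hge l))
    have hdl : 0 < d l := by linarith [hd0 l]
    rw [Real.sq_sqrt (by positivity), le_div_iff₀ hdl, mul_comm]
    refine le_trans ?_ h1
    gcongr
    exact hge l
  · have hcross := cross_ge (g3.trans g4) g6 g7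
    rw [det_eq (hpos 0) (hpos 1)]
    have h0 := hpos 0
    have h1 := hpos 1
    generalize k * dist x (sourcePoint a τ k m j 0) = s at *
    generalize k * dist x (sourcePoint a τ k m j 1) = t at *
    have r1 : √s ≤ 1.05 * √(X / 2) := by
      rw [Real.sqrt_le_left (by positivity), mul_pow, Real.sq_sqrt (by positivity)]
      exact g2
    have r2 : √t ≤ 1.08 * √(X / 2 - π / 2) := by
      rw [Real.sqrt_le_left (by positivity), mul_pow, Real.sq_sqrt (by positivity)]
      exact g5
    have hD0 : d 0 = X / 2 := rfl
    have hD1 : d 1 = X / 2 - π / 2 := rfl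
    beta_reduce
    rw [hD0, hD1, Real.sqrt_div (show (0 : ℝ) ≤ 1.9 by norm_num) (X / 2),
      Real.sqrt_div (show (0 : ℝ) ≤ 1.9 by norm_num) (X / 2 - π / 2)]
    have s1 := Real.sqrt_pos.2 (show 0 < X / 2 by linarith)
    have s2 := Real.sqrt_pos.2 hY0
    have s3 := Real.sqrt_pos.2 h0
    have s4 := Real.sqrt_pos.2 h1
    have s5 : √(1.9 : ℝ) * √1.9 = 1.9 := Real.mul_self_sqrt (by norm_num)
    generalize √(X / 2) = A at *
    generalize √(X / 2 - π / 2) = B at *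
    rw [abs_mul, abs_of_pos (by positivity : 0 < 1 / k ^ 4), abs_sub_comm]
    have h2 : 0.38 / (√t * √s) ≤
        |regSol (-1) t * sumYK s - regSol (-1) s * sumYK t| := by
      refine le_trans ?_ (le_abs_self _)
      rw [div_le_iff₀ (by positivity)]
      linarith
    have h3 : 10 / 64 * 1.9 / (A * B) ≤ 0.38 / (√t * √s) := by
      rw [div_le_div_iff₀ (by positivity) (by positivity)]
      have : √t * √s ≤ (1.08 * B) * (1.05 * A) := by gcongr
      have := mul_pos s1 s2
      linarith
    calc 10 * (√1.9 / A / (8 * k ^ 2) * (√1.9 / B / (8 * k ^ 2)))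
        = 1 / k ^ 4 * (10 / 64 * (√1.9 * √1.9) / (A * B)) := by
          field_simp
          ring
      _ ≤ _ := by
          rw [s5]
          gcongr
          exact h3.trans h2

theorem wellPosedOn_small {a τ k : ℝ} {m j : ℕ} (hm : 10 ≤ m) (ha : 0 < a)
    (hk : k = smallWaveNumber a) :
    ∃ b : Fin 2 → ℝ, (∀ l, 0 < b l) ∧
      WellPosedOn k (arc (radius a τ k) m j) (sourcePoint a τ k m j) b := by
  have hk0 : 0 < k := by rw [hk, smallWaveNumber]; positivity
  have hX : k * radius a τ k = π / 5 := by
    rw [radius, if_pos hk, hk, smallWaveNumber]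
    field_simp
    norm_num
  have hp1 := Real.pi_gt_d4
  have hp2 := Real.pi_lt_d4
  have hsq1 : 0.3947 ≤ (π / 5) ^ 2 := by nlinarith
  have hsq2 : (π / 5) ^ 2 ≤ 0.3949 := by nlinarith
  refine ⟨![1.005 / (8 * k ^ 2), 0.95 / (8 * k ^ 2)], fun l => ?_, fun x hx => ?_⟩
  · fin_cases l
    · simp; positivity
    · simp; positivity
  obtain ⟨c, hc, hc', hdist⟩ := exists_cos_of_mem_arc hm hx
  have e0 := hdist 0
  have e1 := hdist 1
  rw [ratio_zero, hX] at e0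
  rw [ratio_one, if_pos hk, hX] at e1
  have n0 : 0 ≤ k * dist x (sourcePoint a τ k m j 0) := by positivity
  have n1 : 0 ≤ k * dist x (sourcePoint a τ k m j 1) := by positivity
  have f0 : (k * dist x (sourcePoint a τ k m j 0)) ^ 2 = (π / 5) ^ 2 * (1.25 - c) := by
    rw [e0]; ring
  have f1 : (k * dist x (sourcePoint a τ k m j 1)) ^ 2 = (π / 5) ^ 2 * (3.25 + 3 * c) := by
    rw [e1]; ring
  have u0 : 0.3947 * 0.25 ≤ (π / 5) ^ 2 * (1.25 - c) := by gcongr; linarith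
  have v0 : (π / 5) ^ 2 * (1.25 - c) ≤ 0.3949 * 0.3 := by gcongr <;> linarith
  have u1 : 0.3947 * 6.1 ≤ (π / 5) ^ 2 * (3.25 + 3 * c) := by gcongr; linarith
  have v1 : (π / 5) ^ 2 * (3.25 + 3 * c) ≤ 0.3949 * 6.25 := by gcongr; linarith
  have p0 : 0 < k * dist x (sourcePoint a τ k m j 0) := by
    refine lt_of_le_of_ne n0 fun h => ?_
    rw [← h] at f0
    linarith
  have p1 : 0 < k * dist x (sourcePoint a τ k m j 1) := by
    refine lt_of_le_of_ne n1 fun h => ?_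
    rw [← h] at f1
    linarith
  obtain ⟨A1, A2, A3, A4⟩ := bounds_near_inner_point p0 (by linarith) (by linarith)
  obtain ⟨B1, B2, B3, B4⟩ := bounds_near_outer_point p1 (by linarith) (by linarith)
  have N0 : sumYK (k * dist x (sourcePoint a τ k m j 0)) ^ 2 +
      regSol (-1) (k * dist x (sourcePoint a τ k m j 0)) ^ 2 ≤ 1.005 ^ 2 := by
    have := pow_le_pow_left₀ A1 A2 2
    have := pow_le_pow_left₀ (by linarith) A4 2
    linarith
  have N1 : sumYK (k * dist x (sourcePoint a τ k m j 1)) ^ 2 +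
      regSol (-1) (k * dist x (sourcePoint a τ k m j 1)) ^ 2 ≤ 0.95 ^ 2 := by
    have := pow_le_pow_left₀ (by linarith) B2 2
    have := pow_le_pow_left₀ B3 B4 2
    linarith
  have hpos : ∀ l, 0 < k * dist x (sourcePoint a τ k m j l) := by
    intro l; fin_cases l
    · exact p0
    · exact p1
  refine ⟨hpos, fun l => ?_, ?_⟩
  · fin_cases l
    · exact norm_fundSol_le hk0 p0 (by norm_num) N0
    · exact norm_fundSol_le hk0 p1 (by norm_num) N1
  · rw [det_eq p0 p1, abs_mul, abs_of_pos (by positivity : 0 < 1 / k ^ 4)]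
    have h1 : 0.96 * 0.26 ≤ regSol (-1) (k * dist x (sourcePoint a τ k m j 0)) *
        sumYK (k * dist x (sourcePoint a τ k m j 1)) := by gcongr
    have h2 : regSol (-1) (k * dist x (sourcePoint a τ k m j 1)) *
        sumYK (k * dist x (sourcePoint a τ k m j 0)) ≤ 0.49 * 0.1 := by gcongr
    simp only [Matrix.cons_val_zero, Matrix.cons_val_one]
    calc 10 * (1.005 / (8 * k ^ 2) * (0.95 / (8 * k ^ 2))) = 1 / k ^ 4 * (10 / 64 * (1.005 * 0.95)) := by
          field_simp
          norm_num
      _ ≤ _ := by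
          gcongr
          refine le_trans ?_ (le_abs_self _)
          linarith

theorem wellPosedOn_arc {a τ k : ℝ} {m j N : ℕ} (hm : 10 ≤ m) (ha : 0 < a) (hτ : 6 ≤ τ)
    (hk : k ∈ admissible a N) :
    0 < k ∧ ∃ b : Fin 2 → ℝ, (∀ l, 0 < b l) ∧
      WellPosedOn k (arc (radius a τ k) m j) (sourcePoint a τ k m j) b := by
  by_cases hk0 : k = smallWaveNumber a
  · exact ⟨by rw [hk0, smallWaveNumber]; positivity, wellPosedOn_small hm ha hk0⟩
  obtain ⟨l₁, l₂, h1, -, hkl⟩ := hk.resolve_right hk0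
  have hl : (1 : ℝ) ≤ √((l₁ : ℝ) ^ 2 + (l₂ : ℝ) ^ 2) := by
    rw [Real.one_le_sqrt]
    have : (1 : ℤ) ≤ l₁ ^ 2 + l₂ ^ 2 := by
      rcases le_max_iff.1 h1 with h | h
      · nlinarith [sq_abs l₁, sq_nonneg l₂]
      · nlinarith [sq_abs l₂, sq_nonneg l₁]
    exact_mod_cast this
  have hge : π / a ≤ k := by
    rw [hkl]
    exact le_mul_of_one_le_right (by positivity) hl
  have hpos : 0 < k := lt_of_lt_of_le (by positivity) hge
  refine ⟨hpos, wellPosedOn_large hm hpos hk0 ?_⟩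
  rw [radius, if_neg hk0]
  calc 6 * π = π / a * (6 * a) := by field_simp
    _ ≤ k * (τ * a) := by gcongr

/-! ### The norm of `L^∞` on an arc -/

theorem isCompact_arc (R : ℝ) (m j : ℕ) : IsCompact (arc R m j) := by
  refine isCompact_Icc.image ?_
  unfold polar
  fun_prop

theorem measurableSet_arc (R : ℝ) (m j : ℕ) : MeasurableSet (arc R m j) :=
  (isCompact_arc R m j).isClosed.measurableSet

section SupNorm

variable {F : Type*} [NormedAddCommGroup F] {Γ : Set Plane} {f : Plane → F}

theorem supNorm_le_of_ae {C : ℝ}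
    (h : ∀ᵐ x ∂(Measure.hausdorffMeasure 1).restrict Γ, ‖f x‖ ≤ C) :
    supNorm Γ f ≤ ENNReal.ofReal C := by
  rw [supNorm, eLpNorm_exponent_top]
  exact eLpNormEssSup_le_of_ae_bound h

theorem toReal_supNorm_le_of_ae {C : ℝ} (hC : 0 ≤ C)
    (h : ∀ᵐ x ∂(Measure.hausdorffMeasure 1).restrict Γ, ‖f x‖ ≤ C) :
    (supNorm Γ f).toReal ≤ C :=
  ENNReal.toReal_le_of_le_ofReal hC (supNorm_le_of_ae h)

theorem ae_norm_le_of_supNorm_le {C : ℝ} (hC : 0 ≤ C) (h : supNorm Γ f ≤ ENNReal.ofReal C) :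
    ∀ᵐ x ∂(Measure.hausdorffMeasure 1).restrict Γ, ‖f x‖ ≤ C := by
  rw [supNorm, eLpNorm_exponent_top] at h
  filter_upwards [ae_le_eLpNormEssSup (f := f)
    (μ := (Measure.hausdorffMeasure 1).restrict Γ)] with x hx
  have := hx.trans h
  rwa [← ofReal_norm, ENNReal.ofReal_le_ofReal_iff hC] at this

theorem ae_norm_le_supNorm (h : supNorm Γ f < ⊤) :
    ∀ᵐ x ∂(Measure.hausdorffMeasure 1).restrict Γ, ‖f x‖ ≤ (supNorm Γ f).toReal :=
  ae_norm_le_of_supNorm_le ENNReal.toReal_nonneg (by rw [ENNReal.ofReal_toReal h.ne])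

theorem supNorm_eq_zero_of_supNorm_eq_zero {G : Type*} [NormedAddCommGroup G] {g : Plane → G}
    (hΓ : MeasurableSet Γ) (hg : ∀ x ∈ Γ, g x ≠ 0) (h : supNorm Γ g = 0) : supNorm Γ f = 0 := by
  have h1 := ae_norm_le_of_supNorm_le le_rfl (by rw [h]; exact zero_le)
  have h2 : ∀ᵐ x ∂(Measure.hausdorffMeasure 1).restrict Γ, ‖f x‖ ≤ 0 := by
    filter_upwards [h1, ae_restrict_mem hΓ] with x hx hxΓ
    exact absurd (norm_le_zero_iff.1 hx) (hg x hxΓ)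
  simpa using supNorm_le_of_ae h2

end SupNorm

/-! ### Boundedness of the radiated field -/

theorem continuousOn_sumYK_sq_add :
    ContinuousOn (fun t => sumYK t ^ 2 + regSol (-1) t ^ 2) (Ioi 0) := by
  intro t ht
  have h1 := (hasDerivAt_logSol (-1) ht).continuousAt
  have h2 := (hasDerivAt_logSol 1 ht).continuousAt
  have h3 := (hasDerivAt_regSol (-1) ht).continuousAt
  have h4 : ContinuousAt sumYK t := (h1.sub h2).const_mul (2 / π)
  exact ((h4.pow 2).add (h3.pow 2)).continuousWithinAt

theorem exists_norm_fundSol_le {k lo hi : ℝ} (hk : 0 < k) (hlo : 0 < lo) :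
    ∃ C : ℝ, ∀ x y : Plane, lo ≤ dist x y → dist x y ≤ hi → ‖fundSol k x y‖ ≤ C := by
  obtain ⟨C, hC⟩ := (isCompact_Icc (a := k * lo) (b := k * hi)).exists_bound_of_continuousOn
    (continuousOn_sumYK_sq_add.mono fun t ht => lt_of_lt_of_le (by positivity) ht.1)
  refine ⟨√(max C 0) / (8 * k ^ 2), fun x y h1 h2 => ?_⟩
  have h0 : 0 < dist x y := by linarith
  refine norm_fundSol_le hk (by positivity) (Real.sqrt_nonneg _) ?_
  rw [Real.sq_sqrt (le_max_right _ _)]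
  exact (le_abs_self _).trans ((hC _ ⟨by gcongr, by gcongr⟩).trans (le_max_left _ _))

theorem norm_polar {R : ℝ} (hR : 0 ≤ R) (θ : ℝ) : ‖polar R θ‖ = R := by
  have h : polar 0 0 = 0 := by ext i; fin_cases i <;> simp [polar]
  have := dist_polar_sq R 0 θ 0
  rw [h, dist_zero_right] at this
  exact (pow_left_inj₀ (norm_nonneg _) hR two_ne_zero).1 (by linarith)

theorem norm_le_of_mem_square {a : ℝ} (ha : 0 < a) {y : Plane} (hy : y ∈ square a) :
    ‖y‖ ≤ 2 * a := by
  rw [EuclideanSpace.norm_eq, Real.sqrt_le_left (by positivity), Fin.sum_univ_two,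
    Real.norm_eq_abs, Real.norm_eq_abs, sq_abs, sq_abs]
  have h0 := hy 0
  have h1 := hy 1
  nlinarith [h0.1, h0.2, h1.1, h1.2]

theorem exists_norm_field_le {a τ k : ℝ} (ha : 0 < a) (hτ : 6 ≤ τ) (hk : 0 < k) {S : Plane → ℂ}
    (hS : MemLp S 2 volume) (m j : ℕ) :
    ∃ C : ℝ, ∀ x ∈ arc (radius a τ k) m j, ‖field a k S x‖ ≤ C := by
  have hR : 6 * a ≤ radius a τ k := by
    rw [radius]
    split_ifs
    · exact le_rfl
    · gcongr
  obtain ⟨C, hC⟩ := exists_norm_fundSol_le (lo := 4 * a) (hi := radius a τ k + 2 * a) hk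
    (by positivity)
  have hsub : square a ⊆ Metric.closedBall 0 (2 * a) := fun y hy => by
    simpa using norm_le_of_mem_square ha hy
  have hfin : volume (square a) < ⊤ := (measure_mono hsub).trans_lt measure_closedBall_lt_top
  have : IsFiniteMeasure (volume.restrict (square a)) := ⟨by simpa using hfin⟩
  have hint : Integrable S (volume.restrict (square a)) := (hS.restrict _).integrable (by norm_num)
  have hms : MeasurableSet (square a) := by
    have : square a = ⋂ i : Fin 2, (fun x : Plane => x i) ⁻¹' Ioo (-a) a := by
      ext x; simp [square]
    rw [this]
    exact MeasurableSet.iInter fun i => measurableSet_Ioo.preimage (by fun_prop)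
  refine ⟨∫ y in square a, C * ‖S y‖, fun x hx => ?_⟩
  obtain ⟨θ, -, rfl⟩ := hx
  refine norm_integral_le_of_norm_le (hint.norm.const_mul C) ?_
  filter_upwards [ae_restrict_mem hms] with y hy
  rw [norm_mul]
  gcongr
  have h1 := norm_polar (by linarith : 0 ≤ radius a τ k) θ
  have h2 := norm_le_of_mem_square ha hy
  have h3 := norm_sub_norm_le (polar (radius a τ k) θ) y
  have h4 := norm_sub_le (polar (radius a τ k) θ) y
  refine hC _ _ ?_ ?_ <;> rw [dist_eq_norm] <;> linarith

/-! ### Solving the system -/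

theorem existsUnique_of_det_ne_zero {A B r : Fin 2 → ℝ} (h : A 0 * B 1 - A 1 * B 0 ≠ 0) :
    ∃! w : ℂ, ∀ l, A l * w.re + B l * w.im = r l := by
  refine ⟨⟨(r 0 * B 1 - r 1 * B 0) / (A 0 * B 1 - A 1 * B 0),
    (A 0 * r 1 - A 1 * r 0) / (A 0 * B 1 - A 1 * B 0)⟩, fun l => ?_, fun w hw => ?_⟩
  · fin_cases l
    · simp only [Fin.zero_eta]
      rw [← mul_div_assoc, ← mul_div_assoc, ← add_div, div_eq_iff h]
      ring
    · simp only [Fin.mk_one]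
      rw [← mul_div_assoc, ← mul_div_assoc, ← add_div, div_eq_iff h]
      ring
  · have h0 := hw 0
    have h1 := hw 1
    apply Complex.ext
    · simp only
      rw [eq_div_iff h]
      linear_combination B 1 * h0 - B 0 * h1
    · simp only
      rw [eq_div_iff h]
      linear_combination A 0 * h1 - A 1 * h0

/-- The exact field solves the system with the exact moduli. -/
theorem exact_system {k c : ℝ} {z x : Plane} (h : 0 < k * dist x z) (hc : c ≠ 0) (v : ℂ) :
    coeffA k z x * v.re + coeffB k z x * v.im =
      rhs k z x c ‖v‖ ‖v - (c : ℂ) * fundSol k x z‖ := by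
  rw [rhs, ← Complex.normSq_eq_norm_sq, ← Complex.normSq_eq_norm_sq, fundSol_eq h,
    Complex.normSq_apply, Complex.normSq_apply]
  have e1 : (v - (c : ℂ) * (-(1 / 8 : ℂ) * ((coeffA k z x : ℂ) +
      (coeffB k z x : ℂ) * Complex.I))).re = v.re + c / 8 * coeffA k z x := by
    simp
    ring
  have e2 : (v - (c : ℂ) * (-(1 / 8 : ℂ) * ((coeffA k z x : ℂ) +
      (coeffB k z x : ℂ) * Complex.I))).im = v.im + c / 8 * coeffB k z x := by
    simp
    ring
  rw [e1, e2]
  field_simp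
  ring

theorem abs_sq_sub_sq_le {s t ε V : ℝ} (hε : 0 ≤ ε) (ht : 0 ≤ t) (htV : t ≤ V)
    (h : |s - t| ≤ ε * V) : |s ^ 2 - t ^ 2| ≤ ε * (2 + ε) * V ^ 2 := by
  have hV : 0 ≤ V := ht.trans htV
  have h1 : |s + t| ≤ (2 + ε) * V := by
    rw [abs_le] at h ⊢
    constructor <;> linarith
  rw [show s ^ 2 - t ^ 2 = (s - t) * (s + t) by ring, abs_mul]
  calc |s - t| * |s + t| ≤ (ε * V) * ((2 + ε) * V) := by gcongr
    _ = _ := by ring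

/-- Cramer's rule, as an estimate for the solution of the system. -/
theorem norm_le_of_system {k K : ℝ} {x : Plane} {z : Fin 2 → Plane} {b : Fin 2 → ℝ}
    (hb : ∀ l, 0 < b l) (hpos : ∀ l, 0 < k * dist x (z l))
    (hΦ : ∀ l, ‖fundSol k x (z l)‖ ≤ b l)
    (hD : 10 * (b 0 * b 1) ≤
      |coeffA k (z 0) x * coeffB k (z 1) x - coeffA k (z 1) x * coeffB k (z 0) x|)
    {w : ℂ} (hw : ∀ l, |coeffA k (z l) x * w.re + coeffB k (z l) x * w.im| ≤ b l * K) :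
    ‖w‖ ≤ 1.6 * K := by
  set δ : Fin 2 → ℝ := fun l => coeffA k (z l) x * w.re + coeffB k (z l) x * w.im with hδ
  set D := coeffA k (z 0) x * coeffB k (z 1) x - coeffA k (z 1) x * coeffB k (z 0) x with hDdef
  have key : (D : ℂ) * w =
      8 * Complex.I * ((δ 0 : ℂ) * fundSol k x (z 1) - (δ 1 : ℂ) * fundSol k x (z 0)) := by
    rw [fundSol_eq (hpos 0), fundSol_eq (hpos 1), hDdef, hδ]
    apply Complex.ext
    · simp
      ring
    · simp
      ring
  have hK : 0 ≤ K := by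
    by_contra! hK
    have := (abs_nonneg _).trans (hw 0)
    nlinarith [hb 0]
  have hb0 := hb 0
  have hb1 := hb 1
  have h1 : |D| * ‖w‖ ≤ 16 * (b 0 * b 1) * K := by
    have h2 : ‖(D : ℂ) * w‖ = |D| * ‖w‖ := by rw [norm_mul, Complex.norm_real, Real.norm_eq_abs]
    rw [← h2, key, norm_mul, norm_mul, Complex.norm_I]
    calc ‖(8 : ℂ)‖ * 1 * ‖(δ 0 : ℂ) * fundSol k x (z 1) - (δ 1 : ℂ) * fundSol k x (z 0)‖
        ≤ 8 * 1 * (|δ 0| * ‖fundSol k x (z 1)‖ + |δ 1| * ‖fundSol k x (z 0)‖) := by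
          refine mul_le_mul (by norm_num) ((norm_sub_le _ _).trans (le_of_eq ?_))
            (norm_nonneg _) (by norm_num)
          simp only [norm_mul, Complex.norm_real, Real.norm_eq_abs]
      _ ≤ 8 * 1 * ((b 0 * K) * b 1 + (b 1 * K) * b 0) := by
          have := hw 0
          have := hw 1
          have := hΦ 0
          have := hΦ 1
          gcongr
      _ = _ := by ring
  have h3 : 10 * (b 0 * b 1) * ‖w‖ ≤ 16 * (b 0 * b 1) * K :=
    (mul_le_mul_of_nonneg_right hD (norm_nonneg w)).trans h1
  have h4 : 0 < b 0 * b 1 := by positivity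
  by_contra! h5
  nlinarith

theorem constant_le_stabConst {τ ε c₁ c₂ : ℝ} (hτ : 6 ≤ τ) (hε : ε ∈ Ioo (0 : ℝ) 1) (h₁ : 0 ≤ c₁)
    (h₂ : 0 ≤ c₂) :
    1.6 * (4 * (ε * (2 + ε) * ((2 + ε) ^ 2 + 1)) / (1 - ε)) ≤ stabConst τ ε c₁ c₂ := by
  obtain ⟨hε0, hε1⟩ := hε
  have h1ε : 0 < 1 - ε := by linarith
  have hM0 : 0 < constM τ := by
    have : 3 / (2 * τ) ≤ 1 / 4 := by
      rw [div_le_iff₀ (by linarith)]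
      linarith
    rw [constM]
    linarith
  have hM1 : constM τ ≤ 0.87 := by
    have : 0 ≤ 3 / (2 * τ) := by positivity
    rw [constM]
    linarith
  have hsqrt : 1.4 ≤ √2 := Real.le_sqrt_of_sq_le (by norm_num)
  have hη : 4 * ((2 + ε) * ((2 + ε) ^ 2 + 1)) / (1 - ε) ≤ eta ε c₁ c₂ := by
    rw [eta, one_div_mul_eq_div]
    have : 4 * ((2 + ε) * ((2 + ε) ^ 2 + 1)) / (1 - ε) ≤
        (4 * (3 + ε) * (2 + ε) ^ 2 + 4 * (3 + ε) + 8) / (1 - ε) := by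
      gcongr
      nlinarith [sq_nonneg (2 + ε)]
    linarith
  have hη0 : 0 ≤ 4 * ((2 + ε) * ((2 + ε) ^ 2 + 1)) / (1 - ε) := by positivity
  rw [stabConst, le_div_iff₀ hM0]
  calc 1.6 * (4 * (ε * (2 + ε) * ((2 + ε) ^ 2 + 1)) / (1 - ε)) * constM τ
      ≤ 1.6 * (4 * (ε * (2 + ε) * ((2 + ε) ^ 2 + 1)) / (1 - ε)) * 0.87 := by gcongr
    _ = (1.6 * 0.87) * ε * (4 * ((2 + ε) * ((2 + ε) ^ 2 + 1)) / (1 - ε)) := by ring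
    _ ≤ √2 * ε * eta ε c₁ c₂ := by
        gcongr
        norm_num at hsqrt ⊢
        linarith

theorem det_ne_zero_of_wellPosedOn {k : ℝ} {Γ : Set Plane} {z : Fin 2 → Plane} {b : Fin 2 → ℝ}
    (hb : ∀ l, 0 < b l) (hwp : WellPosedOn k Γ z b) {x : Plane} (hx : x ∈ Γ) :
    coeffA k (z 0) x * coeffB k (z 1) x - coeffA k (z 1) x * coeffB k (z 0) x ≠ 0 := by
  have h := (hwp x hx).2.2
  have h0 : 0 < 10 * (b 0 * b 1) := by have := hb 0; have := hb 1; positivity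
  exact abs_pos.1 (h0.trans_le h)

theorem fundSol_ne_zero_of_wellPosedOn {k : ℝ} {Γ : Set Plane} {z : Fin 2 → Plane}
    {b : Fin 2 → ℝ} (hb : ∀ l, 0 < b l) (hwp : WellPosedOn k Γ z b) {x : Plane} (hx : x ∈ Γ)
    (l : Fin 2) : fundSol k x (z l) ≠ 0 := by
  intro h0
  have hsq := norm_fundSol_sq ((hwp x hx).1 l)
  rw [h0, norm_zero] at hsq
  have hA : coeffA k (z l) x = 0 := by
    nlinarith [sq_nonneg (coeffA k (z l) x), sq_nonneg (coeffB k (z l) x)]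
  have hB : coeffB k (z l) x = 0 := by
    nlinarith [sq_nonneg (coeffA k (z l) x), sq_nonneg (coeffB k (z l) x)]
  refine det_ne_zero_of_wellPosedOn hb hwp hx ?_
  fin_cases l
  · simp only [Fin.zero_eta] at hA hB
    rw [hA, hB]; ring
  · simp only [Fin.mk_one] at hA hB
    rw [hA, hB]; ring

/-- Stability of phase retrieval for a bounded field that vanishes almost everywhere. -/
theorem stability_of_supNorm_eq_zero {k ε : ℝ} {Γ : Set Plane} {z : Fin 2 → Plane}
    {b : Fin 2 → ℝ} (hΓ : MeasurableSet Γ) (hb : ∀ l, 0 < b l) (hwp : WellPosedOn k Γ z b)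
    {u : Plane → ℂ} {p : Plane → ℝ} {q : Fin 2 → Plane → ℝ} (hdata : IsNoisyData k ε Γ z u p q)
    (hu : supNorm Γ u = 0) {w : Plane → ℂ}
    (hw : ∀ x ∈ Γ, SolvesAt k z x (fun l => scaling k Γ (z l) p) (p x) (fun l => q l x) (w x)) :
    supNorm Γ (fun x => w x - u x) = 0 := by
  have hu0 := ae_norm_le_of_supNorm_le le_rfl (by rw [hu]; exact zero_le)
  have hn := hdata.noise_field
  rw [hu, mul_zero] at hn
  have hn0 := ae_norm_le_of_supNorm_le le_rfl (hn.trans (zero_le))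
  have hp : supNorm Γ p = 0 := by
    have : ∀ᵐ x ∂(Measure.hausdorffMeasure 1).restrict Γ, ‖p x‖ ≤ 0 := by
      filter_upwards [hu0, hn0] with x h1 h2
      rw [norm_le_zero_iff] at h1 h2 ⊢
      rw [h1, norm_zero, sub_zero] at h2
      exact h2
    simpa using supNorm_le_of_ae this
  have hc : ∀ l, scaling k Γ (z l) p = 0 := fun l => by rw [scaling, hp]; simp
  have hw0 : ∀ x ∈ Γ, w x = 0 := by
    intro x hx
    have h := hw x hx
    simp only [SolvesAt, hc, rhs, div_zero, zero_mul, zero_div, sub_zero] at h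
    exact (existsUnique_of_det_ne_zero (A := fun l => coeffA k (z l) x)
      (B := fun l => coeffB k (z l) x) (r := fun _ => 0)
      (det_ne_zero_of_wellPosedOn hb hwp hx)).unique h (fun l => by simp)
  have : ∀ᵐ x ∂(Measure.hausdorffMeasure 1).restrict Γ, ‖w x - u x‖ ≤ 0 := by
    filter_upwards [hu0, ae_restrict_mem hΓ] with x h1 hx
    rw [hw0 x hx, zero_sub, norm_neg]
    exact h1
  simpa using supNorm_le_of_ae this

/-- Stability of phase retrieval for a bounded field. -/
theorem stability {k ε : ℝ} {Γ : Set Plane} {z : Fin 2 → Plane}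
    {b : Fin 2 → ℝ} (hε : ε ∈ Ioo (0 : ℝ) 1) (hΓ : MeasurableSet Γ) (hb : ∀ l, 0 < b l)
    (hwp : WellPosedOn k Γ z b)
    {u : Plane → ℂ} {p : Plane → ℝ} {q : Fin 2 → Plane → ℝ} (hdata : IsNoisyData k ε Γ z u p q)
    (hu : supNorm Γ u < ⊤) {w : Plane → ℂ}
    (hw : ∀ x ∈ Γ, SolvesAt k z x (fun l => scaling k Γ (z l) p) (p x) (fun l => q l x) (w x)) :
    supNorm Γ (fun x => w x - u x) ≤
      ENNReal.ofReal (1.6 * (4 * (ε * (2 + ε) * ((2 + ε) ^ 2 + 1)) / (1 - ε))) * supNorm Γ u := by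
  obtain ⟨hε0, hε1⟩ := hε
  have h1ε : 0 < 1 - ε := by linarith
  by_cases hu0 : supNorm Γ u = 0
  · rw [stability_of_supNorm_eq_zero hΓ hb hwp hdata hu0 hw]
    exact zero_le
  set U := (supNorm Γ u).toReal with hU
  have hUpos : 0 < U := ENNReal.toReal_pos hu0 hu.ne
  have hUe : supNorm Γ u = ENNReal.ofReal U := (ENNReal.ofReal_toReal hu.ne).symm
  have aeu := ae_norm_le_supNorm hu
  have aep : ∀ᵐ x ∂(Measure.hausdorffMeasure 1).restrict Γ, ‖p x - ‖u x‖‖ ≤ ε * U := by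
    refine ae_norm_le_of_supNorm_le (by positivity) (hdata.noise_field.trans ?_)
    rw [hUe, ← ENNReal.ofReal_mul hε0.le]
  have aep' : ∀ᵐ x ∂(Measure.hausdorffMeasure 1).restrict Γ, ‖p x‖ ≤ (1 + ε) * U := by
    filter_upwards [aeu, aep] with x h1 h2
    rw [Real.norm_eq_abs, abs_le] at *
    have := norm_nonneg (u x)
    constructor <;> linarith
  have hPtop : supNorm Γ p < ⊤ := (supNorm_le_of_ae aep').trans_lt ENNReal.ofReal_lt_top
  set P := (supNorm Γ p).toReal with hP
  have hP1 : P ≤ (1 + ε) * U := toReal_supNorm_le_of_ae (by positivity) aep'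
  have hP2 : (1 - ε) * U ≤ P := by
    have : U ≤ P + ε * U := by
      refine toReal_supNorm_le_of_ae (by positivity) ?_
      filter_upwards [ae_norm_le_supNorm hPtop, aep] with x h1 h2
      rw [Real.norm_eq_abs, abs_le] at h1 h2
      linarith
    linarith
  have hPpos : 0 < P := lt_of_lt_of_le (by positivity) hP2
  set f : Fin 2 → ℝ := fun l => (supNorm Γ (fun x => fundSol k x (z l))).toReal with hf
  have aeb : ∀ l, ∀ᵐ x ∂(Measure.hausdorffMeasure 1).restrict Γ, ‖fundSol k x (z l)‖ ≤ b l := by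
    intro l
    filter_upwards [ae_restrict_mem hΓ] with x hx
    exact (hwp x hx).2.1 l
  have hftop : ∀ l, supNorm Γ (fun x => fundSol k x (z l)) < ⊤ := fun l =>
    (supNorm_le_of_ae (aeb l)).trans_lt ENNReal.ofReal_lt_top
  have hfb : ∀ l, f l ≤ b l := fun l => toReal_supNorm_le_of_ae (hb l).le (aeb l)
  have hfpos : ∀ l, 0 < f l := fun l => ENNReal.toReal_pos (fun h => hu0
    (supNorm_eq_zero_of_supNorm_eq_zero hΓ
      (fun x hx => fundSol_ne_zero_of_wellPosedOn hb hwp hx l) h)) (hftop l).ne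
  have hc : ∀ l, scaling k Γ (z l) p = P / f l := fun l => rfl
  have aev : ∀ l, ∀ᵐ x ∂(Measure.hausdorffMeasure 1).restrict Γ,
      ‖u x - (scaling k Γ (z l) p : ℂ) * fundSol k x (z l)‖ ≤ (2 + ε) * U := by
    intro l
    filter_upwards [aeu, ae_norm_le_supNorm (hftop l)] with x h1 h2
    refine (norm_sub_le _ _).trans ?_
    rw [norm_mul, Complex.norm_real, hc, Real.norm_eq_abs, abs_of_pos (div_pos hPpos (hfpos l))]
    have h3 : P / f l * ‖fundSol k x (z l)‖ ≤ P / f l * f l :=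
      mul_le_mul_of_nonneg_left h2 (div_pos hPpos (hfpos l)).le
    rw [div_mul_cancel₀ _ (hfpos l).ne'] at h3
    linarith
  have aeq : ∀ l, ∀ᵐ x ∂(Measure.hausdorffMeasure 1).restrict Γ,
      ‖q l x - ‖u x - (scaling k Γ (z l) p : ℂ) * fundSol k x (z l)‖‖ ≤ ε * ((2 + ε) * U) := by
    intro l
    refine ae_norm_le_of_supNorm_le (by positivity) ((hdata.noise_aux l).trans ?_)
    rw [ENNReal.ofReal_mul hε0.le]
    gcongr
    exact supNorm_le_of_ae (aev l)
  rw [hUe, ← ENNReal.ofReal_mul (by positivity)]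
  refine supNorm_le_of_ae ?_
  filter_upwards [ae_restrict_mem hΓ, aeu, aep, ae_all_iff.2 aev, ae_all_iff.2 aeq]
    with x hx h1 h2 h3 h4
  obtain ⟨hpos, hΦ, hD⟩ := hwp x hx
  rw [mul_assoc]
  refine norm_le_of_system hb hpos hΦ hD fun l => ?_
  have hcpos : 0 < P / f l := div_pos hPpos (hfpos l)
  have e1 := hw x hx l
  have e2 := exact_system (hpos l) (hc l ▸ hcpos.ne' : scaling k Γ (z l) p ≠ 0) (u x)
  have e3 : coeffA k (z l) x * (w x - u x).re + coeffB k (z l) x * (w x - u x).im =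
      4 * (f l / P) * ((q l x ^ 2 - ‖u x - (scaling k Γ (z l) p : ℂ) * fundSol k x (z l)‖ ^ 2)
        - (p x ^ 2 - ‖u x‖ ^ 2)) := by
    simp only [rhs] at e1 e2
    rw [Complex.sub_re, Complex.sub_im]
    have e4 : 4 / scaling k Γ (z l) p = 4 * (f l / P) := by
      rw [hc]
      have := hfpos l
      field_simp
    rw [e4] at e1 e2
    linear_combination e1 - e2
  have m1 := abs_sq_sub_sq_le hε0.le (norm_nonneg _) (h3 l) (h4 l)
  have m2 := abs_sq_sub_sq_le hε0.le (norm_nonneg _) h1 h2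
  have hfP : f l / P ≤ b l / ((1 - ε) * U) :=
    div_le_div₀ (hb l).le (hfb l) (by positivity) hP2
  rw [e3, abs_mul, abs_of_pos (by have := hfpos l; positivity)]
  calc 4 * (f l / P) * |q l x ^ 2 - ‖u x - (scaling k Γ (z l) p : ℂ) * fundSol k x (z l)‖ ^ 2
        - (p x ^ 2 - ‖u x‖ ^ 2)|
      ≤ 4 * (b l / ((1 - ε) * U)) *
        (ε * (2 + ε) * ((2 + ε) * U) ^ 2 + ε * (2 + ε) * U ^ 2) := by
        have := hb l
        gcongr
        exact (abs_sub _ _).trans (add_le_add m1 m2)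
    _ = _ := by
        field_simp

end PhaseRetrieval

end

theorem mainTheorem3
    (a τ ε : ℝ) (ha : 0 < a) (hτ : 6 ≤ τ) (hε : ε ∈ Set.Ioo (0 : ℝ) 1)
    (m N : ℕ) (hm : 10 ≤ m) (hN : 1 ≤ N)
    (S : Plane → ℂ) (hS : MeasureTheory.MemLp S 2 MeasureTheory.volume)
    (hsupp : ∀ᵐ y, y ∉ PhaseRetrieval.square a → S y = 0)
    (k : ℝ) (hk : k ∈ PhaseRetrieval.admissible a N)
    (j : ℕ) (hj : j ∈ Finset.Icc 1 m)
    (Γ : Set Plane) (hΓ : Γ = PhaseRetrieval.arc (PhaseRetrieval.radius a τ k) m j)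
    (z : Fin 2 → Plane) (hz : z = PhaseRetrieval.sourcePoint a τ k m j)
    (u : Plane → ℂ) (hu : u = PhaseRetrieval.field a k S)
    (p : Plane → ℝ) (q : Fin 2 → Plane → ℝ)
    (hdata : PhaseRetrieval.IsNoisyData k ε Γ z u p q) :
    PhaseRetrieval.supNorm Γ u < ⊤ ∧
    (∀ x ∈ Γ, ∃! w : ℂ, PhaseRetrieval.SolvesAt k z x
      (fun l => PhaseRetrieval.scaling k Γ (z l) p) (p x) (fun l => q l x) w) ∧
    ∀ uε : Plane → ℂ,
      (∀ x ∈ Γ, PhaseRetrieval.SolvesAt k z x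
        (fun l => PhaseRetrieval.scaling k Γ (z l) p) (p x) (fun l => q l x) (uε x)) →
      PhaseRetrieval.supNorm Γ (fun x => uε x - u x) ≤
        ENNReal.ofReal (PhaseRetrieval.stabConst τ ε
          (PhaseRetrieval.scaling k Γ (z 0) u) (PhaseRetrieval.scaling k Γ (z 1) u)) *
        PhaseRetrieval.supNorm Γ u := by
  subst hΓ hz hu
  obtain ⟨hk0, b, hb, hwp⟩ := PhaseRetrieval.wellPosedOn_arc (j := j) hm ha hτ hk
  have hmeas := PhaseRetrieval.measurableSet_arc (PhaseRetrieval.radius a τ k) m j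
  have htop : PhaseRetrieval.supNorm (PhaseRetrieval.arc (PhaseRetrieval.radius a τ k) m j)
      (PhaseRetrieval.field a k S) < ⊤ := by
    obtain ⟨C, hC⟩ := PhaseRetrieval.exists_norm_field_le (τ := τ) ha hτ hk0 hS m j
    refine (PhaseRetrieval.supNorm_le_of_ae (C := C) ?_).trans_lt ENNReal.ofReal_lt_top
    filter_upwards [ae_restrict_mem hmeas] with x hx using hC x hx
  refine ⟨htop, fun x hx => ?_, fun uε huε => ?_⟩
  · exact PhaseRetrieval.existsUnique_of_det_ne_zero
      (A := fun l => PhaseRetrieval.coeffA k (PhaseRetrieval.sourcePoint a τ k m j l) x)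
      (B := fun l => PhaseRetrieval.coeffB k (PhaseRetrieval.sourcePoint a τ k m j l) x)
      (PhaseRetrieval.det_ne_zero_of_wellPosedOn hb hwp hx)
  · refine (PhaseRetrieval.stability hε hmeas hb hwp hdata htop huε).trans ?_
    gcongr
    refine PhaseRetrieval.constant_le_stabConst hτ hε ?_ ?_ <;>
      exact div_nonneg ENNReal.toReal_nonneg ENNReal.toReal_nonneg
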